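/- Let $M$ be a connected oriented 3-manifold with an ideal triangulation, i.e. $M$ is obtained from finitely many tetrahedra without their vertices by gluing their faces in pairs by orientation-reversing affine maps. Let $F\subset M$ be a connected closed normal surface, i.e. $F$ is connected, non-empty, and meets each tetrahedron in finitely many pairwise disjoint elementary disks, each of which cuts off a vertex (a triangle) or separates two opposite edges (a quadrilateral). An elementary disk is the cone over its polygonal boundary from the centroid of its corners (so it is flat if its corners are coplanar). The dual 1-skeleton of $M$ is the multigraph with one vertex for each tetrahedron and one edge for each pair of glued faces; the dual 1-skeleton of $F$ has one vertex for each elementary disk and one edge for each arc in which two disks meet in a face. Every edge $e$ of the dual 1-skeleton of $F$ crosses a face, and so has a corresponding edge $\phi(e)$ in the dual 1-skeleton of $M$. All edges are given an orientation, compatibly with $\phi$. Consider the following algorithm, whose input is the combinatorial data of $M$ and of the decomposition of $F$ into disks. (a) Choose a disk of $F$; its centroid is the basepoint $x_0$. (b) Grow, edge by edge, trees $\mathcal T_F$ and $\mathcal T_M$ in the dual 1-skeleta of $F$ and $M$, starting from the chosen disk and from the tetrahedron that contains it, until all vertices are reached. (c), (d) For each edge $e$ of the dual 1-skeleton of $F$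 not in $\mathcal T_F$, form the cycle $\gamma_e$ that runs from the basepoint disk in $\mathcal T_F$ to the start of $e$, along $e$, and back in $\mathcal T_F$. (e), (f) Replace each edge of $\gamma_e$ by the corresponding edge of the dual 1-skeleton of $M$, omit the edges that lie in $\mathcal T_M$, and read the others as letters; the result is a word $w_e$ in the edges not in $\mathcal T_M$ and their inverses. Output the list of all pairs $(e,w_e)$. Then, whatever choices are made: 1. The algorithm terminates: it has no infinite run, and it never stops before it has produced an output. 2. The output is correct. $\mathcal T_F$ and $\mathcal T_M$ are spanning trees of the dual 1-skeleta. The classes $g_e$ of the loops $\gamma_e$, for the edges $e\notin\mathcal T_F$, generate $\pi_1(F,x_0)$. The classes $h_d$, for the edges $d\notin\mathcal T_M$, of the loops that run from $x_0$ straight to the barycentre of its tetrahedron, in $\mathcal T_M$ to the start of $d$, along $d$, back in $\mathcal T_M$, and straight back to $x_0$, generate $\pi_1(M,x_0)$. The output contains each edge $e\notin\mathcal T_F$ exactly once, $w_e$ is a word in the edges $d\notin\mathcal T_M$ and their inverses, and if $i:F\to M$ is the inclusion, then $$i_*(g_e)=w_e\big((h_d)_{d\notin\mathcal T_M}\big)\in\pi_1(M,x_0)\qquad\text{for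 every edge } e\notin\mathcal T_F .$$ So the output describes the homomorphism $i_*:\pi_1(F,x_0)\to\pi_1(M,x_0)$ induced by the inclusion. -/

import Mathlib

namespace SkeletalEmbedding

/-! ### Dual graphs and walks -/

/-- A multigraph, given by its oriented edges ("darts"): `D` is the set of darts, `src d` is the
vertex at which `d` starts, and `rev d` is the same edge traversed backwards.  Each edge carries a
preferred orientation: exactly one of `d`, `rev d` is `positive`. -/
structure DualGraph (V D : Type) where
  src : D → V
  rev : D → D
  positive : D → Bool
  rev_rev : ∀ d, rev (rev d) = d
  positive_rev : ∀ d, positive (rev d) = !positive d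

namespace DualGraph

variable {V D : Type} (G : DualGraph V D)

/-- The vertex at which a dart ends. -/
def tgt (d : D) : V := G.src (G.rev d)

/-- Walks (edge paths) from one vertex to another. -/
inductive Walk : V → V → Type
  | nil (v : V) : Walk v v
  | cons (d : D) {w : V} (p : Walk (G.tgt d) w) : Walk (G.src d) w

variable {G}

/-- The darts traversed by a walk. -/
def Walk.darts : {u v : V} → G.Walk u v → List D
  | _, _, .nil _ => []
  | _, _, .cons d p => d :: p.darts

/-- Concatenation of walks. -/
def Walk.append : {u v w : V} → G.Walk u v → G.Walk v w → G.Walk u w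
  | _, _, _, .nil _, q => q
  | _, _, _, .cons d p, q => .cons d (p.append q)

/-- A walk is reduced if it never traverses an edge and then immediately the same edge back. -/
def Walk.Reduced {u v : V} (p : G.Walk u v) : Prop :=
  p.darts.IsChain (fun d d' => d' ≠ G.rev d)

variable (G)

/-- The edge underlying `d` is one of the edges in the list `S`. -/
def InTree (S : List D) (d : D) : Prop := d ∈ S ∨ G.rev d ∈ S

/-- The edges in the list `S` form a spanning tree: any two vertices are joined by exactly one
reduced walk that uses only edges in `S`. -/
def IsSpanningTree (S : List D) : Prop :=
  ∀ u v : V, ∃! p : G.Walk u v, p.Reduced ∧ ∀ d ∈ p.darts, G.InTree S d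

/-- The generators belonging to a tree `S`: the edges that are not in `S`, each one represented by
its positive dart. -/
def IsGenerator (S : List D) (d : D) : Prop := G.positive d = true ∧ ¬ G.InTree S d

/-- The letter of a dart: `d` itself if it is positive, the inverse of `rev d` otherwise. -/
def letter (d : D) : D × Bool :=
  if G.positive d = true then (d, true) else (G.rev d, false)

variable {G}

/-- The reduced walk in a spanning tree between two vertices. -/
noncomputable def treeWalk {S : List D} (h : G.IsSpanningTree S) (u v : V) : G.Walk u v :=
  (h u v).choose

/-- The closed walk at `r` of an edge `e`: in the tree from `r` to the start of `e`, along `e`, and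
in the tree back to `r`. -/
noncomputable def treeLoop {S : List D} (h : G.IsSpanningTree S) (r : V) (e : D) : G.Walk r r :=
  (treeWalk h r (G.src e)).append (.cons e (treeWalk h (G.tgt e) r))

/-- The path in a space `X` traced by a walk, when each vertex `v` is placed at the point `c v` and
each dart `d` is realised by a path `ρ d`. -/
noncomputable def Walk.path {X : Type} [TopologicalSpace X] {c : V → X}
    (ρ : ∀ d : D, Path (c (G.src d)) (c (G.tgt d))) :
    {u v : V} → G.Walk u v → Path (c u) (c v)
  | _, _, .nil v => Path.refl (c v)
  | _, _, .cons d p => (ρ d).trans (p.path ρ)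

end DualGraph

/-- The words in an alphabet `A` and the inverses of its letters. -/
abbrev Word (A : Type) : Type := List (A × Bool)

/-- The element of the fundamental group spelled by a word in generators `g` and their inverses.
The loops of the word are traversed from left to right; in Mathlib's `FundamentalGroup` the product
`p * q` is the loop `q` followed by the loop `p`. -/
noncomputable def evalWord {A X : Type} [TopologicalSpace X] {x : X}
    (g : A → FundamentalGroup X x) : Word A → FundamentalGroup X x
  | [] => 1
  | (a, ε) :: w => evalWord g w * (if ε = true then g a else (g a)⁻¹)

/-! ### Ideal triangulations -/

/-- An oriented ideal triangulation with finitely many tetrahedra, as combinatorial data.  Faces of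
a tetrahedron are labelled by the opposite vertex.  Face `f` of tetrahedron `i` is glued to face
`perm i f f` of tetrahedron `nbr i f`, by the affine map sending each vertex `a ≠ f` to
`perm i f a`.  The gluings are orientation reversing on faces (the permutations are odd), so that
the orientations of the tetrahedra fit together. -/
structure IdealTriangulation where
  n : ℕ
  nbr : Fin n → Fin 4 → Fin n
  perm : Fin n → Fin 4 → Equiv.Perm (Fin 4)
  nbr_nbr : ∀ i f, nbr (nbr i f) (perm i f f) = i
  perm_perm : ∀ i f, perm (nbr i f) (perm i f f) = (perm i f).symm
  no_fixed_face : ∀ i f, (nbr i f, perm i f f) ≠ (i, f)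
  odd : ∀ i f, Equiv.Perm.sign (perm i f) = -1

/-- The ideal tetrahedron, in barycentric coordinates: a 3-simplex without its four vertices. -/
def idealTet : Set (Fin 4 → ℝ) := {x | x ∈ stdSimplex ℝ (Fin 4) ∧ ∀ a, x a < 1}

theorem convex_idealTet : Convex ℝ idealTet := by
  have h : idealTet = stdSimplex ℝ (Fin 4) ∩ ⋂ a, {x : Fin 4 → ℝ | x a < 1} := by
    ext x; simp [idealTet]
  rw [h]
  refine (convex_stdSimplex ℝ (Fin 4)).inter (convex_iInter fun a => ?_)
  exact convex_halfSpace_lt (LinearMap.proj (R := ℝ) (φ := fun _ : Fin 4 => ℝ) a).isLinear 1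

/-- The straight path between two points of a convex set. -/
noncomputable def segIn {s : Set (Fin 4 → ℝ)} (hs : Convex ℝ s) {x y : Fin 4 → ℝ}
    (hx : x ∈ s) (hy : y ∈ s) : Path (⟨x, hx⟩ : s) ⟨y, hy⟩ where
  toFun t := ⟨AffineMap.lineMap x y (t : ℝ), hs.lineMap_mem hx hy t.2⟩
  continuous_toFun := by
    refine Continuous.subtype_mk ?_ _
    exact AffineMap.lineMap_continuous.comp continuous_subtype_val
  source' := by simp
  target' := by simp

/-- Relabelling of the barycentric coordinates: vertex `a` goes to vertex `π a`. -/
def relabel (π : Equiv.Perm (Fin 4)) (x : Fin 4 → ℝ) : Fin 4 → ℝ := fun a => x (π.symm a)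

namespace IdealTriangulation

variable (T : IdealTriangulation)

/-- The gluing of the disjoint union of the ideal tetrahedra along the faces. -/
def Glue (p q : Fin T.n × idealTet) : Prop :=
  ∃ f : Fin 4, p.2.1 f = 0 ∧ q.1 = T.nbr p.1 f ∧ q.2.1 = relabel (T.perm p.1 f) p.2.1

/-- The manifold `M`: the quotient of the disjoint union of the ideal tetrahedra by the gluing. -/
def Space : Type := Quot T.Glue

instance : TopologicalSpace T.Space := inferInstanceAs (TopologicalSpace (Quot T.Glue))

/-- The point `x` of the `i`-th tetrahedron, as a point of `M`. -/
def pt (i : Fin T.n) (x : idealTet) : T.Space := Quot.mk _ (i, x)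

theorem continuous_pt (i : Fin T.n) : Continuous (T.pt i) :=
  continuous_quot_mk.comp (by fun_prop : Continuous fun x : idealTet => (i, x))

/-- The dual 1-skeleton of `M`: one vertex for each tetrahedron, one edge for each pair of glued
faces.  The dart `(i, f)` leaves tetrahedron `i` through its face `f`. -/
def dual : DualGraph (Fin T.n) (Fin T.n × Fin 4) where
  src d := d.1
  rev d := (T.nbr d.1 d.2, T.perm d.1 d.2 d.2)
  positive d := decide (toLex d < toLex (T.nbr d.1 d.2, T.perm d.1 d.2 d.2))
  rev_rev d := by
    obtain ⟨i, f⟩ := d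
    simp [T.nbr_nbr, T.perm_perm]
  positive_rev d := by
    obtain ⟨i, f⟩ := d
    have h := T.no_fixed_face i f
    have h' : toLex (T.nbr i f, T.perm i f f) ≠ toLex (i, f) := fun e => h (toLex.injective e)
    simp only [T.nbr_nbr, T.perm_perm, Equiv.symm_apply_apply]
    rcases lt_or_gt_of_ne h' with h1 | h1
    · simp [h1, h1.not_gt]
    · simp [h1, h1.not_gt]

/-- The barycentre of a tetrahedron. -/
noncomputable def barycentre : Fin 4 → ℝ := fun _ => 1 / 4

/-- The barycentre of the face opposite to the vertex `f`. -/
noncomputable def faceCentre (f : Fin 4) : Fin 4 → ℝ := fun a => if a = f then 0 else 1 / 3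

theorem barycentre_mem : barycentre ∈ idealTet := by
  refine ⟨⟨fun _ => by norm_num [barycentre], ?_⟩, fun _ => by norm_num [barycentre]⟩
  norm_num [barycentre]

theorem faceCentre_mem (f : Fin 4) : faceCentre f ∈ idealTet := by
  refine ⟨⟨fun a => ?_, ?_⟩, fun a => ?_⟩
  · unfold faceCentre; split_ifs <;> norm_num
  · fin_cases f <;> simp [faceCentre, Fin.sum_univ_four] <;> norm_num
  · unfold faceCentre; split_ifs <;> norm_num

/-- The vertices of the dual 1-skeleton, placed in `M`. -/
noncomputable def centre (i : Fin T.n) : T.Space := T.pt i ⟨barycentre, barycentre_mem⟩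

/-- Half of a dual edge: from the barycentre of a tetrahedron straight to that of a face. -/
noncomputable def halfEdge (i : Fin T.n) (f : Fin 4) :
    Path (T.centre i) (T.pt i ⟨faceCentre f, faceCentre_mem f⟩) :=
  (segIn convex_idealTet barycentre_mem (faceCentre_mem f)).map (T.continuous_pt i)

theorem glue_faceCentre (i : Fin T.n) (f : Fin 4) :
    T.pt i ⟨faceCentre f, faceCentre_mem f⟩ =
      T.pt (T.nbr i f) ⟨faceCentre (T.perm i f f), faceCentre_mem _⟩ := by
  refine Quot.sound ⟨f, by simp [faceCentre], rfl, ?_⟩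
  funext a
  simp only [faceCentre, relabel, Equiv.symm_apply_eq]

/-- The edges of the dual 1-skeleton, realised in `M`: straight to the centre of the face, and
straight on to the barycentre of the next tetrahedron. -/
noncomputable def dualEdge (d : Fin T.n × Fin 4) :
    Path (T.centre (T.dual.src d)) (T.centre (T.dual.tgt d)) :=
  (T.halfEdge d.1 d.2).trans
    ((T.halfEdge (T.nbr d.1 d.2) (T.perm d.1 d.2 d.2)).symm.cast (T.glue_faceCentre d.1 d.2) rfl)

/-- The element of `π₁(M, x)`, for a point `x` of the `i`-th tetrahedron, that belongs to an edge
`d` of the dual 1-skeleton: straight to the barycentre, then along the tree to `d`, along `d`, along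
the tree back, and straight to `x`. -/
noncomputable def generator {S : List (Fin T.n × Fin 4)} (h : T.dual.IsSpanningTree S)
    (i : Fin T.n) (x : idealTet) (d : Fin T.n × Fin 4) : FundamentalGroup T.Space (T.pt i x) :=
  let σ : Path (T.pt i x) (T.centre i) :=
    (segIn convex_idealTet x.2 barycentre_mem).map (T.continuous_pt i)
  FundamentalGroup.fromPath (Path.Homotopic.Quotient.mk
    (σ.trans (((DualGraph.treeLoop h i d).path T.dualEdge).trans σ.symm)))

end IdealTriangulation

/-! ### Normal surfaces -/

/-- The seven types of elementary disks in a tetrahedron: `tri v` cuts off the vertex `v`, and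
`quad k` separates the vertices `0`, `k + 1` from the other two. -/
inductive DiskType
  | tri (v : Fin 4)
  | quad (k : Fin 3)

namespace DiskType

/-- The two sides of a disk: which vertices lie on the same side as the vertex cut off (for a
triangle), or as the vertex `0` (for a quadrilateral). -/
def side : DiskType → Fin 4 → Bool
  | tri v, a => decide (a = v)
  | quad k, a => decide (a = 0 ∨ a = k.succ)

/-- The edges of the tetrahedron that are met by the disk, each one listed in both directions. -/
def edges (t : DiskType) : Finset (Fin 4 × Fin 4) :=
  Finset.univ.filter fun e => t.side e.1 ≠ t.side e.2

/-- Those among them that lie in the face opposite to `f`. -/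
def faceEdges (t : DiskType) (f : Fin 4) : Finset (Fin 4 × Fin 4) :=
  t.edges.filter fun e => e.1 ≠ f ∧ e.2 ≠ f

/-- The disk meets the face opposite to `f` (in an arc). -/
def Meets (t : DiskType) (f : Fin 4) : Prop := (t.faceEdges f).Nonempty

theorem edges_nonempty (t : DiskType) : t.edges.Nonempty := by
  cases t with
  | tri v => revert v; decide
  | quad k => revert k; decide

end DiskType

/-- The average of a finite family of points. -/
noncomputable def average (s : Finset (Fin 4 × Fin 4)) (c : Fin 4 × Fin 4 → Fin 4 → ℝ) :
    Fin 4 → ℝ := (s.card : ℝ)⁻¹ • ∑ e ∈ s, c e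

theorem average_mem {s : Finset (Fin 4 × Fin 4)} {c : Fin 4 × Fin 4 → Fin 4 → ℝ}
    {C : Set (Fin 4 → ℝ)} (hC : Convex ℝ C) (hs : s.Nonempty) (h : ∀ e ∈ s, c e ∈ C) :
    average s c ∈ C := by
  unfold average
  rw [Finset.smul_sum]
  refine hC.sum_mem (fun _ _ => by positivity) ?_ h
  have : (s.card : ℝ) ≠ 0 := by exact_mod_cast hs.card_pos.ne'
  simp [this]

namespace DiskType

/-- The point of the edge `ab`, for `e = (a, b)`, whose barycentric coordinates at `a` and `b` are
`p a b` and `p b a`. -/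
noncomputable def corner (p : Fin 4 → Fin 4 → ℝ) (e : Fin 4 × Fin 4) : Fin 4 → ℝ :=
  p e.1 e.2 • Pi.single e.1 1 + p e.2 e.1 • Pi.single e.2 1

variable (t : DiskType) (p : Fin 4 → Fin 4 → ℝ)

/-- The centroid of the corners of a disk.  (`edges` counts every corner twice, which does not
change the average.) -/
noncomputable def centroid : Fin 4 → ℝ := average t.edges (corner p)

/-- The midpoint of the arc in which a disk meets the face opposite to `f`. -/
noncomputable def arcMid (f : Fin 4) : Fin 4 → ℝ := average (t.faceEdges f) (corner p)

/-- The cone, with apex the centroid, over the arc in which a disk meets the face opposite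
to `f`. -/
noncomputable def sector (f : Fin 4) : Set (Fin 4 → ℝ) :=
  convexHull ℝ (insert (t.centroid p) (corner p '' (t.faceEdges f : Set (Fin 4 × Fin 4))))

/-- The elementary disk with given corners: the cone from the centroid of the corners over the
boundary polygon.  When the corners lie in a plane (in particular for a triangle) this is the planar
polygon spanned by them. -/
noncomputable def carrier : Set (Fin 4 → ℝ) := ⋃ f ∈ {f | t.Meets f}, t.sector p f

variable {t p}

theorem convex_sector (f : Fin 4) : Convex ℝ (t.sector p f) := convex_convexHull ℝ _

theorem centroid_mem_sector (f : Fin 4) : t.centroid p ∈ t.sector p f :=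
  subset_convexHull ℝ _ (Set.mem_insert _ _)

theorem arcMid_mem_sector {f : Fin 4} (h : t.Meets f) : t.arcMid p f ∈ t.sector p f :=
  average_mem (convex_sector f) h fun _ he =>
    subset_convexHull ℝ _ (Set.mem_insert_of_mem _ (Set.mem_image_of_mem _ he))

end DiskType

/-- The cell structure of a closed normal surface in `T`, as combinatorial data: finitely many
elementary disks, each one with its tetrahedron and its type, and for each disk `D` and each face
`f` of its tetrahedron that `D` meets, the disk `nbr D f` on the other side of the face that has the
same arc in common with the face (the value of `nbr D f` is irrelevant if `D` does not meet `f`).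
This is the input of the algorithm. -/
structure NormalCells (T : IdealTriangulation) where
  m : ℕ
  tet : Fin m → Fin T.n
  type : Fin m → DiskType
  nbr : Fin m → Fin 4 → Fin m
  tet_nbr : ∀ D f, (type D).Meets f → tet (nbr D f) = T.nbr (tet D) f
  side_nbr : ∀ D f, (type D).Meets f → ∀ a b, a ≠ f → b ≠ f →
    ((type (nbr D f)).side (T.perm (tet D) f a) ≠ (type (nbr D f)).side (T.perm (tet D) f b) ↔
      (type D).side a ≠ (type D).side b)
  nbr_nbr : ∀ D f, (type D).Meets f → nbr (nbr D f) (T.perm (tet D) f f) = D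

namespace NormalCells

variable {T : IdealTriangulation} (F : NormalCells T)

/-- The sides of the disks: pairs of a disk and a face of its tetrahedron that it meets. -/
def Dart : Type := {p : Fin F.m × Fin 4 // (F.type p.1).Meets p.2}

theorem faceEdges_nbr {D : Fin F.m} {f : Fin 4} (h : (F.type D).Meets f) (e : Fin 4 × Fin 4) :
    (T.perm (F.tet D) f e.1, T.perm (F.tet D) f e.2) ∈
        (F.type (F.nbr D f)).faceEdges (T.perm (F.tet D) f f) ↔
      e ∈ (F.type D).faceEdges f := by
  have hs := F.side_nbr D f h e.1 e.2
  simp only [DiskType.faceEdges, DiskType.edges, Finset.mem_filter, Finset.mem_univ, true_and,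
    ne_eq, EmbeddingLike.apply_eq_iff_eq] at hs ⊢
  tauto

theorem meets_nbr {D : Fin F.m} {f : Fin 4} (h : (F.type D).Meets f) :
    (F.type (F.nbr D f)).Meets (T.perm (F.tet D) f f) := by
  obtain ⟨e, he⟩ := id h
  exact ⟨_, (F.faceEdges_nbr h e).2 he⟩

/-- The edge of the dual 1-skeleton of `M` that corresponds to an edge of the dual 1-skeleton of
`F`: the one through the face in which the two disks meet. -/
def toDart (e : F.Dart) : Fin T.n × Fin 4 := (F.tet e.1.1, e.1.2)

/-- The dual 1-skeleton of `F`: one vertex for each elementary disk, one edge for each arc in which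
two disks meet.  The edges are oriented as those of the dual 1-skeleton of `M`. -/
def dual : DualGraph (Fin F.m) F.Dart where
  src e := e.1.1
  rev e := ⟨(F.nbr e.1.1 e.1.2, T.perm (F.tet e.1.1) e.1.2 e.1.2), F.meets_nbr e.2⟩
  positive e := T.dual.positive (F.toDart e)
  rev_rev e := by
    obtain ⟨⟨D, f⟩, h⟩ := e
    apply Subtype.ext
    simp only [F.nbr_nbr D f h, F.tet_nbr D f h, T.perm_perm, Equiv.symm_apply_apply]
  positive_rev e := by
    rw [← T.dual.positive_rev]
    obtain ⟨⟨D, f⟩, h⟩ := e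
    simp only [toDart, IdealTriangulation.dual, F.tet_nbr D f h]

end NormalCells

/-- A closed normal surface in `M`.  If the disk `D` meets the edge `ab` of its tetrahedron, it does
so in one interior point of the edge, whose barycentric coordinates at `a` and `b` are `pos D a b`
and `pos D b a`.  The gluing of the faces of the tetrahedra matches the arcs of adjacent disks.
Different disks in a tetrahedron are disjoint. -/
structure NormalSurface (T : IdealTriangulation) extends NormalCells T where
  pos : Fin m → Fin 4 → Fin 4 → ℝ
  pos_pos : ∀ D a b, (type D).side a ≠ (type D).side b → 0 < pos D a b
  pos_add : ∀ D a b, (type D).side a ≠ (type D).side b → pos D a b + pos D b a = 1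
  pos_nbr : ∀ D f, (type D).Meets f → ∀ a b, a ≠ f → b ≠ f →
    (type D).side a ≠ (type D).side b →
    pos (nbr D f) (T.perm (tet D) f a) (T.perm (tet D) f b) = pos D a b
  disjoint : ∀ D D', D ≠ D' → tet D = tet D' →
    Disjoint ((type D).carrier (pos D)) ((type D').carrier (pos D'))

namespace NormalSurface

variable {T : IdealTriangulation} (F : NormalSurface T)

/-- The normal surface, as a subset of `M`: the union of its elementary disks. -/
def carrier : Set T.Space :=
  {q | ∃ D, ∃ x : idealTet, x.1 ∈ (F.type D).carrier (F.pos D) ∧ q = T.pt (F.tet D) x}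

/-- The inclusion of the surface in `M`. -/
def incl : C(F.carrier, T.Space) := ⟨Subtype.val, continuous_subtype_val⟩

theorem corner_mem (D : Fin F.m) {e : Fin 4 × Fin 4} (he : e ∈ (F.type D).edges) :
    DiskType.corner (F.pos D) e ∈ idealTet := by
  obtain ⟨a, b⟩ := e
  have hs : (F.type D).side a ≠ (F.type D).side b := by simpa [DiskType.edges] using he
  have hab : a ≠ b := fun h => hs (by rw [h])
  have h1 := F.pos_pos D a b hs
  have h2 := F.pos_pos D b a hs.symm
  have h3 := F.pos_add D a b hs
  refine ⟨⟨fun c => ?_, ?_⟩, fun c => ?_⟩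
  · simp only [DiskType.corner, Pi.add_apply, Pi.smul_apply, Pi.single_apply, smul_eq_mul]
    split_ifs <;> simp <;> linarith
  · simp [DiskType.corner, Finset.sum_add_distrib, ← Finset.mul_sum, h3]
  · simp only [DiskType.corner, Pi.add_apply, Pi.smul_apply, Pi.single_apply, smul_eq_mul]
    by_cases ha : c = a
    · simp [ha, hab]; linarith
    · by_cases hb : c = b
      · simp [hb, hab.symm]; linarith
      · simp [ha, hb]

theorem centroid_mem (D : Fin F.m) : (F.type D).centroid (F.pos D) ∈ idealTet :=
  average_mem convex_idealTet (F.type D).edges_nonempty fun _ he => F.corner_mem D he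

theorem sector_subset (D : Fin F.m) (f : Fin 4) : (F.type D).sector (F.pos D) f ⊆ idealTet := by
  refine convexHull_min ?_ convex_idealTet
  rintro x (rfl | ⟨e, he, rfl⟩)
  · exact F.centroid_mem D
  · exact F.corner_mem D (Finset.mem_filter.1 he).1

/-- The points of a sector of a disk, as points of the surface. -/
def sectorPt (D : Fin F.m) {f : Fin 4} (h : (F.type D).Meets f)
    (x : (F.type D).sector (F.pos D) f) : F.carrier :=
  ⟨T.pt (F.tet D) ⟨x.1, F.sector_subset D f x.2⟩,
    D, ⟨x.1, F.sector_subset D f x.2⟩, Set.mem_biUnion (x := f) h x.2, rfl⟩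

theorem continuous_sectorPt (D : Fin F.m) {f : Fin 4} (h : (F.type D).Meets f) :
    Continuous (F.sectorPt D h) := by
  refine Continuous.subtype_mk ((T.continuous_pt _).comp ?_) _
  exact Continuous.subtype_mk continuous_subtype_val _

theorem centroid_mem_carrier (D : Fin F.m) :
    (F.type D).centroid (F.pos D) ∈ (F.type D).carrier (F.pos D) := by
  obtain ⟨f, hf⟩ : ∃ f, (F.type D).Meets f := by
    generalize F.type D = t
    unfold DiskType.Meets
    cases t with
    | tri v => revert v; decide
    | quad k => revert k; decide
  exact Set.mem_biUnion (x := f) hf (DiskType.centroid_mem_sector f)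

/-- The vertices of the dual 1-skeleton of `F`: the centroids of the disks. -/
noncomputable def centre (D : Fin F.m) : F.carrier :=
  ⟨T.pt (F.tet D) ⟨(F.type D).centroid (F.pos D), F.centroid_mem D⟩,
    D, ⟨_, F.centroid_mem D⟩, F.centroid_mem_carrier D, rfl⟩

/-- The midpoint of an arc in which two disks meet. -/
noncomputable def mid (e : F.Dart) : F.carrier :=
  F.sectorPt e.1.1 e.2 ⟨(F.type e.1.1).arcMid (F.pos e.1.1) e.1.2, DiskType.arcMid_mem_sector e.2⟩

/-- Half of a dual edge: from the centroid of a disk straight to the midpoint of an arc. -/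
noncomputable def halfEdge (e : F.Dart) : Path (F.centre (F.dual.src e)) (F.mid e) :=
  (segIn (DiskType.convex_sector e.1.2) (DiskType.centroid_mem_sector e.1.2)
    (DiskType.arcMid_mem_sector e.2)).map (F.continuous_sectorPt e.1.1 e.2)

theorem arcMid_nbr {D : Fin F.m} {f : Fin 4} (h : (F.type D).Meets f) :
    (F.type (F.nbr D f)).arcMid (F.pos (F.nbr D f)) (T.perm (F.tet D) f f) =
      relabel (T.perm (F.tet D) f) ((F.type D).arcMid (F.pos D) f) := by
  set π := T.perm (F.tet D) f with hπ
  have key : (F.type (F.nbr D f)).faceEdges (π f) =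
      ((F.type D).faceEdges f).map (π.prodCongr π).toEmbedding := by
    ext ⟨a, b⟩
    have := F.faceEdges_nbr h (π.symm a, π.symm b)
    rw [Finset.mem_map_equiv]
    simpa [← hπ] using this
  unfold DiskType.arcMid average
  rw [key, Finset.card_map, Finset.sum_map]
  funext c
  simp only [relabel, Pi.smul_apply, Finset.sum_apply]
  congr 1
  refine Finset.sum_congr rfl fun e he => ?_
  simp only [DiskType.faceEdges, DiskType.edges, Finset.mem_filter, Finset.mem_univ,
    true_and] at he
  have h1 := F.pos_nbr D f h e.1 e.2 he.2.1 he.2.2 he.1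
  have h2 := F.pos_nbr D f h e.2 e.1 he.2.2 he.2.1 he.1.symm
  rw [← hπ] at h1 h2
  simp [DiskType.corner, h1, h2, Pi.single_apply, Equiv.symm_apply_eq]

theorem mid_rev (e : F.Dart) : F.mid e = F.mid (F.dual.rev e) := by
  obtain ⟨⟨D, f⟩, h⟩ := e
  apply Subtype.ext
  have key : ∀ (i j : Fin T.n) (_ : j = T.nbr i f) (x y : idealTet), x.1 f = 0 →
      y.1 = relabel (T.perm i f) x.1 → T.pt i x = T.pt j y :=
    fun i j hij x y hx hy => Quot.sound ⟨f, hx, hij, hy⟩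
  refine key _ _ (F.tet_nbr D f h) _ _ ?_ (F.arcMid_nbr h)
  simp only [DiskType.arcMid, average, Pi.smul_apply, Finset.sum_apply, smul_eq_mul]
  refine mul_eq_zero_of_right _ (Finset.sum_eq_zero fun e he => ?_)
  have he := (Finset.mem_filter.1 he).2
  simp [DiskType.corner, he.1.symm, he.2.symm]

/-- The edges of the dual 1-skeleton, realised in `F`: straight to the midpoint of the arc, and
straight on to the centroid of the next disk. -/
noncomputable def dualEdge (e : F.Dart) :
    Path (F.centre (F.dual.src e)) (F.centre (F.dual.tgt e)) :=
  (F.halfEdge e).trans ((F.halfEdge (F.dual.rev e)).symm.cast (F.mid_rev e) rfl)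

/-- The element of `π₁(F)`, with basepoint in the disk `b`, that belongs to an edge `e` of the dual
1-skeleton: along the tree to `e`, along `e`, and along the tree back. -/
noncomputable def generator {S : List F.Dart} (h : F.dual.IsSpanningTree S) (b : Fin F.m)
    (e : F.Dart) : FundamentalGroup F.carrier (F.centre b) :=
  FundamentalGroup.fromPath (Path.Homotopic.Quotient.mk
    ((DualGraph.treeLoop h b e).path F.dualEdge))

end NormalSurface

/-! ### The algorithm -/

/-- The choices made by the algorithm: a basepoint disk, and lists of edges forming trees in the
dual 1-skeleta of the surface and of the manifold. -/
structure Choices (V D D' : Type) where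
  base : V
  treeF : List D
  treeM : List D'

/-- The states of the algorithm. -/
inductive State (V D D' : Type)
  /-- nothing has been done -/
  | start
  /-- a basepoint disk has been chosen, and a tree in `F` is being grown from it -/
  | growF (b : V) (S : List D)
  /-- the tree in `F` is finished, and a tree in `M` is being grown -/
  | growM (b : V) (S : List D) (S' : List D')
  /-- the generators in `out` have been treated, and the next one is to be selected -/
  | select (R : Choices V D D') (out : List (D × Word D'))
  /-- the path `γ` along the tree and the edge `e` is being traced back from `v` to the basepoint -/
  | traceBack (R : Choices V D D') (out : List (D × Word D')) (e : D) (v : V) (γ : List D)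
  /-- the path `γ` has reached `v` behind `e`, and is being continued in the tree to the basepoint -/
  | traceHome (R : Choices V D D') (out : List (D × Word D')) (e : D) (v : V) (γ : List D)
  /-- the word `w` has been read off, and the edges in `γ` remain to be translated -/
  | translate (R : Choices V D D') (out : List (D × Word D')) (e : D) (γ : List D) (w : Word D')
  /-- the algorithm has halted with output `out`: a list of generators and their words -/
  | done (R : Choices V D D') (out : List (D × Word D'))

/-- The vertex `v` belongs to the tree that has been grown from `r` with edges `S`. -/
def DualGraph.Reached {V D : Type} (G : DualGraph V D) (r : V) (S : List D) (v : V) : Prop :=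
  v = r ∨ ∃ d ∈ S, G.tgt d = v

namespace NormalCells

variable {T : IdealTriangulation} (F : NormalCells T)

/-- The states of the algorithm for the surface `F`. -/
abbrev AlgState : Type := State (Fin F.m) F.Dart (Fin T.n × Fin 4)

/-- The single steps of the algorithm.  Where several steps are possible (choice of the basepoint
disk, of the trees, of the order of the generators), any of them may be taken. -/
inductive Step : F.AlgState → F.AlgState → Prop
  /-- choose a basepoint disk -/
  | basepoint (b) : Step .start (.growF b [])
  /-- add an edge of the dual 1-skeleton of `F` that leads out of the tree -/
  | growF {b S} (d) (h : F.dual.Reached b S (F.dual.src d))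
      (h' : ¬ F.dual.Reached b S (F.dual.tgt d)) :
      Step (.growF b S) (.growF b (S ++ [d]))
  /-- the tree in `F` is spanning -/
  | grownF {b S} (h : ∀ v, F.dual.Reached b S v) : Step (.growF b S) (.growM b S [])
  /-- add an edge of the dual 1-skeleton of `M` that leads out of the tree -/
  | growM {b S S'} (d) (h : T.dual.Reached (F.tet b) S' (T.dual.src d))
      (h' : ¬ T.dual.Reached (F.tet b) S' (T.dual.tgt d)) :
      Step (.growM b S S') (.growM b S (S' ++ [d]))
  /-- the tree in `M` is spanning -/
  | grownM {b S S'} (h : ∀ v, T.dual.Reached (F.tet b) S' v) :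
      Step (.growM b S S') (.select ⟨b, S, S'⟩ [])
  /-- select a generator that has not been treated -/
  | select {R out} (e) (h : F.dual.IsGenerator R.treeF e) (h' : e ∉ out.map Prod.fst) :
      Step (.select R out) (.traceBack R out e (F.dual.src e) [e])
  /-- prepend the tree edge `d` that leads to the start of the path -/
  | back {R out e γ} (d) (h : d ∈ R.treeF) (h' : F.dual.tgt d ≠ R.base) :
      Step (.traceBack R out e (F.dual.tgt d) γ) (.traceBack R out e (F.dual.src d) (d :: γ))
  /-- the path starts at the basepoint -/
  | turn {R out e γ} : Step (.traceBack R out e R.base γ) (.traceHome R out e (F.dual.tgt e) γ)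
  /-- append the reverse of the tree edge `d` -/
  | home {R out e γ} (d) (h : d ∈ R.treeF) (h' : F.dual.tgt d ≠ R.base) :
      Step (.traceHome R out e (F.dual.tgt d) γ)
        (.traceHome R out e (F.dual.src d) (γ ++ [F.dual.rev d]))
  /-- the path is closed -/
  | closed {R out e γ} : Step (.traceHome R out e R.base γ) (.translate R out e γ [])
  /-- the edge of the dual 1-skeleton of `M` corresponding to `d` belongs to the tree in `M` -/
  | skip {R out e d γ w} (h : T.dual.InTree R.treeM (F.toDart d)) :
      Step (.translate R out e (d :: γ) w) (.translate R out e γ w)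
  /-- the edge of the dual 1-skeleton of `M` corresponding to `d` is a generator or its inverse -/
  | letter {R out e d γ w} (h : ¬ T.dual.InTree R.treeM (F.toDart d)) :
      Step (.translate R out e (d :: γ) w)
        (.translate R out e γ (w ++ [T.dual.letter (F.toDart d)]))
  /-- the word of the generator `e` is complete -/
  | record {R out e w} : Step (.translate R out e [] w) (.select R (out ++ [(e, w)]))
  /-- all generators have been treated -/
  | finish {R out} (h : ∀ e, F.dual.IsGenerator R.treeF e → e ∈ out.map Prod.fst) :
      Step (.select R out) (.done R out)

end NormalCells

end SkeletalEmbedding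

namespace SkeletalEmbedding

/-! ### Walks as lists of darts, and trees grown edge by edge -/

namespace DualGraph

section Lists

variable {V D : Type} (G : DualGraph V D)

/-- The list `l` of darts is an edge path from `u` to `v`. -/
def IsWalk : V → List D → V → Prop
  | u, [], v => u = v
  | u, d :: l, v => G.src d = u ∧ IsWalk (G.tgt d) l v

variable {G}

theorem src_rev (d : D) : G.src (G.rev d) = G.tgt d := rfl

theorem tgt_rev (d : D) : G.tgt (G.rev d) = G.src d := by
  simp [tgt, G.rev_rev]

theorem IsWalk.append {u v w : V} {l l' : List D} (h : G.IsWalk u l v) (h' : G.IsWalk v l' w) :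
    G.IsWalk u (l ++ l') w := by
  induction l generalizing u with
  | nil => cases h; exact h'
  | cons d l ih => exact ⟨h.1, ih h.2⟩

theorem isWalk_singleton (d : D) : G.IsWalk (G.src d) [d] (G.tgt d) := ⟨rfl, rfl⟩

theorem IsWalk.reverse {u v : V} {l : List D} (h : G.IsWalk u l v) :
    G.IsWalk v (l.map G.rev).reverse u := by
  induction l generalizing u with
  | nil => exact Eq.symm h
  | cons d l ih =>
    obtain ⟨rfl, h⟩ := h
    rw [List.map_cons, List.reverse_cons]
    refine (ih h).append ?_
    have := isWalk_singleton (G := G) (G.rev d)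
    rwa [tgt_rev, src_rev] at this

theorem Walk.isWalk_darts {u v : V} (p : G.Walk u v) : G.IsWalk u p.darts v := by
  induction p with
  | nil v => rfl
  | cons d p ih => exact ⟨rfl, ih⟩

theorem IsWalk.exists_walk {u v : V} {l : List D} (h : G.IsWalk u l v) :
    ∃ p : G.Walk u v, p.darts = l := by
  induction l generalizing u with
  | nil => cases h; exact ⟨.nil _, rfl⟩
  | cons d l ih =>
    obtain ⟨rfl, h⟩ := h
    obtain ⟨p, rfl⟩ := ih h
    exact ⟨.cons d p, rfl⟩

theorem Walk.heq_of_darts_eq {u v u' v' : V} (p : G.Walk u v) (q : G.Walk u' v') (hu : u = u')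
    (hv : v = v') (h : p.darts = q.darts) : p ≍ q := by
  induction p generalizing u' with
  | nil v =>
    cases q with
    | nil v' => subst hu; rfl
    | cons d q => cases h
  | cons d p ih =>
    cases q with
    | nil v' => cases h
    | cons d' q =>
      simp only [Walk.darts, List.cons.injEq] at h
      obtain ⟨rfl, h⟩ := h
      subst hv
      cases eq_of_heq (ih q rfl rfl h)
      rfl

theorem Walk.darts_injective {u v : V} {p q : G.Walk u v} (h : p.darts = q.darts) : p = q :=
  eq_of_heq (p.heq_of_darts_eq q rfl rfl h)

theorem Walk.darts_append {u v w : V} (p : G.Walk u v) (q : G.Walk v w) :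
    (p.append q).darts = p.darts ++ q.darts := by
  induction p with
  | nil v => rfl
  | cons d p ih => simp [Walk.append, Walk.darts, ih]

theorem InTree.rev {S : List D} {d : D} (h : G.InTree S d) : G.InTree S (G.rev d) := by
  unfold InTree at *
  rw [G.rev_rev]
  exact h.symm

/-- Every edge path can be reduced without changing its endpoints or the product of the labels of
its darts, when reversed darts have inverse labels. -/
theorem IsWalk.exists_reduced {M : Type*} [Group M] {g : D → M}
    (hg : ∀ d, g (G.rev d) = (g d)⁻¹) {u v : V} {l : List D} (h : G.IsWalk u l v) :
    ∃ l', G.IsWalk u l' v ∧ l'.IsChain (fun d d' => d' ≠ G.rev d) ∧ (∀ d ∈ l', d ∈ l) ∧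
      (l'.map g).prod = (l.map g).prod := by
  induction l generalizing u with
  | nil => exact ⟨[], h, .nil, fun _ h => h, rfl⟩
  | cons d l ih =>
    obtain ⟨rfl, h⟩ := h
    obtain ⟨l', h1, h2, h3, h4⟩ := ih h
    by_cases hd : ∃ t, l' = G.rev d :: t
    · obtain ⟨t, rfl⟩ := hd
      refine ⟨t, ?_, ?_, fun x hx => ?_, ?_⟩
      · have := h1.2
        rwa [tgt_rev] at this
      · exact h2.tail
      · exact List.mem_cons_of_mem _ (h3 x (List.mem_cons_of_mem _ hx))
      · rw [List.map_cons, List.prod_cons, ← h4, List.map_cons, List.prod_cons, hg,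
          mul_inv_cancel_left]
    · refine ⟨d :: l', ⟨rfl, h1⟩, ?_, fun x hx => ?_, ?_⟩
      · cases l' with
        | nil => exact .singleton d
        | cons d' t => exact List.IsChain.cons_cons (fun e => hd ⟨t, by rw [e]⟩) h2
      · rcases List.mem_cons.1 hx with rfl | hx
        · exact List.mem_cons_self
        · exact List.mem_cons_of_mem _ (h3 x hx)
      · simp [h4]

/-- In a spanning tree, the product of labels along an edge path only depends on its endpoints. -/
theorem IsSpanningTree.prod_eq {S : List D} (hS : G.IsSpanningTree S) {M : Type*} [Group M]
    {g : D → M} (hg : ∀ d, g (G.rev d) = (g d)⁻¹) {u v : V} {l l' : List D}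
    (h : G.IsWalk u l v) (hl : ∀ d ∈ l, G.InTree S d) (h' : G.IsWalk u l' v)
    (hl' : ∀ d ∈ l', G.InTree S d) : (l.map g).prod = (l'.map g).prod := by
  obtain ⟨m, h1, h2, h3, h4⟩ := h.exists_reduced hg
  obtain ⟨m', h1', h2', h3', h4'⟩ := h'.exists_reduced hg
  obtain ⟨p, rfl⟩ := h1.exists_walk
  obtain ⟨p', rfl⟩ := h1'.exists_walk
  rw [← h4, ← h4', (hS u v).unique ⟨h2, fun d hd => hl d (h3 d hd)⟩
    ⟨h2', fun d hd => hl' d (h3' d hd)⟩]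

theorem treeWalk_inTree {S : List D} (hS : G.IsSpanningTree S) (u v : V) :
    ∀ d ∈ (treeWalk hS u v).darts, G.InTree S d :=
  (hS u v).choose_spec.1.2

theorem treeWalk_self {S : List D} (hS : G.IsSpanningTree S) (u : V) :
    treeWalk hS u u = .nil u :=
  (hS u u).unique (hS u u).choose_spec.1 ⟨.nil, fun _ h => by cases h⟩

theorem treeLoop_darts {S : List D} (hS : G.IsSpanningTree S) (r : V) (e : D) :
    (treeLoop hS r e).darts =
      (treeWalk hS r (G.src e)).darts ++ e :: (treeWalk hS (G.tgt e) r).darts :=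
  Walk.darts_append _ _

variable (G)

/-- The list `S` of darts has been grown from `r`, each dart leading out of the tree formed by the
previous ones. -/
inductive Grown (r : V) : List D → Prop
  | nil : Grown r []
  | snoc {S : List D} {d : D} (hS : Grown r S) (h : G.Reached r S (G.src d))
      (h' : ¬ G.Reached r S (G.tgt d)) : Grown r (S ++ [d])

variable {G}

theorem reached_snoc {r v : V} {S : List D} {d : D} :
    G.Reached r (S ++ [d]) v ↔ G.Reached r S v ∨ G.tgt d = v := by
  simp only [Reached, List.mem_append, List.mem_singleton]
  constructor
  · rintro (h | ⟨e, h | rfl, h'⟩)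
    · exact .inl (.inl h)
    · exact .inl (.inr ⟨e, h, h'⟩)
    · exact .inr h'
  · rintro ((h | ⟨e, h, h'⟩) | h)
    · exact .inl h
    · exact .inr ⟨e, .inl h, h'⟩
    · exact .inr ⟨d, .inr rfl, h⟩

theorem Grown.reached_src {r : V} {S : List D} (hS : G.Grown r S) {d : D} (hd : d ∈ S) :
    G.Reached r S (G.src d) := by
  induction hS with
  | nil => cases hd
  | snoc _ h _ ih =>
    rw [List.mem_append, List.mem_singleton] at hd
    rcases hd with hd | rfl
    · exact reached_snoc.2 (.inl (ih hd))
    · exact reached_snoc.2 (.inl h)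

/-- Functions on the vertices of a grown tree can be defined by recursion from the root. -/
theorem Grown.exists_rec {r : V} {S : List D} (hS : G.Grown r S) {A : Type*} (a : A)
    (f : D → A → A) : ∃ φ : V → A, φ r = a ∧ ∀ d ∈ S, φ (G.tgt d) = f d (φ (G.src d)) := by
  classical
  induction hS with
  | nil => exact ⟨fun _ => a, rfl, fun _ h => by cases h⟩
  | @snoc S d hS h h' ih =>
    obtain ⟨φ, h1, h2⟩ := ih
    have key : ∀ v, G.Reached r S v →
        Function.update φ (G.tgt d) (f d (φ (G.src d))) v = φ v := fun v hv =>
      Function.update_of_ne (fun e : v = G.tgt d => h' (e ▸ hv)) _ _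
    refine ⟨Function.update φ (G.tgt d) (f d (φ (G.src d))), ?_, fun e he => ?_⟩
    · rw [key r (.inl rfl), h1]
    · rw [List.mem_append, List.mem_singleton] at he
      rcases he with he | rfl
      · rw [key _ (.inr ⟨e, he, rfl⟩), key _ (hS.reached_src he), h2 e he]
      · rw [Function.update_self, key _ h]

theorem Grown.exists_depth {r : V} {S : List D} (hS : G.Grown r S) :
    ∃ φ : V → ℕ, ∀ d ∈ S, φ (G.src d) < φ (G.tgt d) := by
  obtain ⟨φ, -, h⟩ := hS.exists_rec 0 fun _ n => n + 1
  exact ⟨φ, fun d hd => by rw [h d hd]; exact Nat.lt_succ_self _⟩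

open Classical in
/-- The signed letter of a dart relative to an orientation given by a list of darts. -/
noncomputable def signed (G : DualGraph V D) (S : List D) (d : D) : D × Bool :=
  if d ∈ S then (d, true) else (G.rev d, false)

theorem signed_injective (S : List D) : Function.Injective (G.signed S) := by
  intro d d' h
  unfold signed at h
  split_ifs at h with h1 h2 h2
  · exact (Prod.ext_iff.1 h).1
  · simp at h
  · simp at h
  · rw [← G.rev_rev d, show G.rev d = G.rev d' from (Prod.ext_iff.1 h).1, G.rev_rev]

theorem isReduced_signed {S : List D} {l : List D} (h : l.IsChain (fun d d' => d' ≠ G.rev d)) :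
    FreeGroup.IsReduced (l.map (G.signed S)) := by
  unfold FreeGroup.IsReduced
  rw [List.isChain_map]
  refine h.imp fun d d' hd => ?_
  unfold signed
  split_ifs with h1 h2 h2
  · simp
  · intro e
    exact absurd (by simp only at e; rw [e, G.rev_rev]) hd
  · intro e
    exact absurd e.symm hd
  · simp

/-- A grown tree contains at most one reduced edge path between two vertices. -/
theorem Grown.reduced_unique {r : V} {S : List D} (hS : G.Grown r S) {u v : V} {l l' : List D}
    (h : G.IsWalk u l v) (hl : ∀ d ∈ l, G.InTree S d)
    (hr : l.IsChain (fun d d' => d' ≠ G.rev d)) (h' : G.IsWalk u l' v)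
    (hl' : ∀ d ∈ l', G.InTree S d) (hr' : l'.IsChain (fun d d' => d' ≠ G.rev d)) : l = l' := by
  classical
  obtain ⟨φ, -, hφ⟩ := hS.exists_rec (1 : FreeGroup D) fun d x => x * FreeGroup.of d
  have key : ∀ {u v : V} {l : List D}, G.IsWalk u l v → (∀ d ∈ l, G.InTree S d) →
      FreeGroup.mk (l.map (G.signed S)) = (φ u)⁻¹ * φ v := by
    intro u v l h hl
    induction l generalizing u with
    | nil => cases h; simp [FreeGroup.one_eq_mk]
    | cons d l ih =>
      obtain ⟨rfl, h⟩ := h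
      rw [List.map_cons, ← List.singleton_append, ← FreeGroup.mul_mk,
        ih h fun e he => hl e (List.mem_cons_of_mem _ he), ← mul_assoc]
      congr 1
      rw [mul_inv_eq_iff_eq_mul, eq_inv_mul_iff_mul_eq]
      by_cases hd : d ∈ S
      · rw [hφ d hd, signed, if_pos hd, FreeGroup.of]
      · have hd' := (hl d List.mem_cons_self).resolve_left hd
        have := hφ _ hd'
        rw [tgt_rev, src_rev] at this
        rw [signed, if_neg hd, this, mul_assoc, FreeGroup.of, FreeGroup.mul_mk]
        have h1 : FreeGroup.mk ([(G.rev d, true)] ++ [(G.rev d, false)]) = 1 := by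
          have := mul_inv_cancel (FreeGroup.of (G.rev d))
          rwa [FreeGroup.of, FreeGroup.inv_mk, FreeGroup.mul_mk] at this
        rw [h1, mul_one]
  have h1 := (key h hl).trans (key h' hl').symm
  have h2 := congrArg FreeGroup.toWord h1
  rw [FreeGroup.toWord_mk, FreeGroup.toWord_mk, (isReduced_signed hr).reduce_eq,
    (isReduced_signed hr').reduce_eq] at h2
  exact List.map_injective_iff.2 (signed_injective S) h2

theorem Grown.exists_walk {r : V} {S : List D} (hS : G.Grown r S) {v : V}
    (hv : G.Reached r S v) : ∃ l, G.IsWalk r l v ∧ ∀ d ∈ l, G.InTree S d := by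
  induction hS generalizing v with
  | nil =>
    rcases hv with rfl | ⟨_, h, _⟩
    · exact ⟨[], rfl, fun _ h => by cases h⟩
    · cases h
  | @snoc S d hS h h' ih =>
    have mono : ∀ e, G.InTree S e → G.InTree (S ++ [d]) e := fun e he =>
      he.imp (List.mem_append_left _) (List.mem_append_left _)
    rcases reached_snoc.1 hv with hv | rfl
    · obtain ⟨l, h1, h2⟩ := ih hv
      exact ⟨l, h1, fun e he => mono e (h2 e he)⟩
    · obtain ⟨l, h1, h2⟩ := ih h
      refine ⟨l ++ [d], h1.append (isWalk_singleton d), fun e he => ?_⟩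
      rw [List.mem_append, List.mem_singleton] at he
      rcases he with he | rfl
      · exact mono e (h2 e he)
      · exact .inl (by simp)

theorem Grown.isSpanningTree {r : V} {S : List D} (hS : G.Grown r S)
    (h : ∀ v, G.Reached r S v) : G.IsSpanningTree S := by
  intro u v
  obtain ⟨l, h1, h2⟩ := hS.exists_walk (h u)
  obtain ⟨l', h1', h2'⟩ := hS.exists_walk (h v)
  obtain ⟨m, h3, h4, h5, -⟩ := (h1.reverse.append h1').exists_reduced
    (g := fun _ => (1 : Multiplicative ℤ)) (by simp)
  obtain ⟨p, rfl⟩ := h3.exists_walk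
  have hp : ∀ d ∈ p.darts, G.InTree S d := by
    intro d hd
    rcases List.mem_append.1 (h5 d hd) with h | h
    · rw [List.mem_reverse, List.mem_map] at h
      obtain ⟨e, he, rfl⟩ := h
      exact (h2 e he).rev
    · exact h2' d h
  exact ⟨p, ⟨h4, hp⟩, fun q hq => Walk.darts_injective
    (hS.reduced_unique q.isWalk_darts hq.2 hq.1 h3 hp h4)⟩

variable (G)

/-- Any two vertices are joined by an edge path. -/
def Connected : Prop := ∀ u v, ∃ l, G.IsWalk u l v

variable {G}

theorem Connected.exists_dart_leaving (hG : G.Connected) {r : V} {S : List D}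
    (h : ¬ ∀ v, G.Reached r S v) :
    ∃ d, G.Reached r S (G.src d) ∧ ¬ G.Reached r S (G.tgt d) := by
  push Not at h
  obtain ⟨v, hv⟩ := h
  obtain ⟨l, hl⟩ := hG r v
  have : ∀ (l : List D) (u : V), G.IsWalk u l v → G.Reached r S u →
      ∃ d, G.Reached r S (G.src d) ∧ ¬ G.Reached r S (G.tgt d) := by
    intro l
    induction l with
    | nil => intro u hu hr; cases hu; exact absurd hr hv
    | cons d l ih =>
      rintro _ ⟨rfl, hu⟩ hr
      by_cases hd : G.Reached r S (G.tgt d)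
      · exact ih _ hu hd
      · exact ⟨d, hr, hd⟩
  exact this l r hl (.inl rfl)

end Lists

end DualGraph

/-! ### Runs of the algorithm -/

namespace NormalCells

section Algorithm

variable {T : IdealTriangulation} (F : NormalCells T)

instance finite_dart : Finite F.Dart := Subtype.finite

theorem toDart_rev (e : F.Dart) : F.toDart (F.dual.rev e) = T.dual.rev (F.toDart e) := by
  obtain ⟨⟨D, f⟩, h⟩ := e
  simp [toDart, dual, IdealTriangulation.dual, F.tet_nbr D f h]

open Classical in
/-- The word read off from a list of edges of the dual 1-skeleton of `F`. -/
noncomputable def readWord (S : List (Fin T.n × Fin 4)) (γ : List F.Dart) :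
    Word (Fin T.n × Fin 4) :=
  γ.flatMap fun d => if T.dual.InTree S (F.toDart d) then [] else [T.dual.letter (F.toDart d)]

theorem readWord_append (S : List (Fin T.n × Fin 4)) (γ γ' : List F.Dart) :
    F.readWord S (γ ++ γ') = F.readWord S γ ++ F.readWord S γ' :=
  List.flatMap_append

/-- Both trees are complete. -/
structure GoodChoices (R : Choices (Fin F.m) F.Dart (Fin T.n × Fin 4)) : Prop where
  grownF : F.dual.Grown R.base R.treeF
  reachedF : ∀ v, F.dual.Reached R.base R.treeF v
  grownM : T.dual.Grown (F.tet R.base) R.treeM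
  reachedM : ∀ v, T.dual.Reached (F.tet R.base) R.treeM v

/-- The edge path runs from `u` to `v` in the tree `S`. -/
def IsTreeWalk (S : List F.Dart) (u : Fin F.m) (l : List F.Dart) (v : Fin F.m) : Prop :=
  F.dual.IsWalk u l v ∧ ∀ d ∈ l, F.dual.InTree S d

variable {F}

theorem IsTreeWalk.nil (S : List F.Dart) (u : Fin F.m) : F.IsTreeWalk S u [] u :=
  ⟨rfl, fun _ h => by cases h⟩

theorem IsTreeWalk.cons {S : List F.Dart} {d : F.Dart} (hd : d ∈ S) {l : List F.Dart}
    {v : Fin F.m} (h : F.IsTreeWalk S (F.dual.tgt d) l v) :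
    F.IsTreeWalk S (F.dual.src d) (d :: l) v :=
  ⟨⟨rfl, h.1⟩, List.forall_mem_cons.2 ⟨.inl hd, h.2⟩⟩

theorem IsTreeWalk.snoc_rev {S : List F.Dart} {d : F.Dart} (hd : d ∈ S) {l : List F.Dart}
    {u : Fin F.m} (h : F.IsTreeWalk S u l (F.dual.tgt d)) :
    F.IsTreeWalk S u (l ++ [F.dual.rev d]) (F.dual.src d) := by
  refine ⟨h.1.append ⟨rfl, DualGraph.tgt_rev d⟩, fun e he => ?_⟩
  rw [List.mem_append, List.mem_singleton] at he
  rcases he with he | rfl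
  · exact h.2 e he
  · exact DualGraph.InTree.rev (.inl hd)

variable (F)

/-- The list `γ` is the closed edge path of the generator `e`. -/
def IsTraced (R : Choices (Fin F.m) F.Dart (Fin T.n × Fin 4)) (e : F.Dart) (γ : List F.Dart) :
    Prop :=
  ∃ l l', γ = l ++ e :: l' ∧ F.IsTreeWalk R.treeF R.base l (F.dual.src e) ∧
    F.IsTreeWalk R.treeF (F.dual.tgt e) l' R.base

/-- The recorded generators are distinct, and their words are correct. -/
def IsRecord (R : Choices (Fin F.m) F.Dart (Fin T.n × Fin 4))
    (out : List (F.Dart × Word (Fin T.n × Fin 4))) : Prop :=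
  (out.map Prod.fst).Nodup ∧ ∀ p ∈ out, F.dual.IsGenerator R.treeF p.1 ∧
    ∃ γ, F.IsTraced R p.1 γ ∧ p.2 = F.readWord R.treeM γ

/-- The generator `e` can be treated next. -/
def IsPending (R : Choices (Fin F.m) F.Dart (Fin T.n × Fin 4))
    (out : List (F.Dart × Word (Fin T.n × Fin 4))) (e : F.Dart) : Prop :=
  F.dual.IsGenerator R.treeF e ∧ e ∉ out.map Prod.fst

/-- The invariant of the algorithm. -/
def Inv : F.AlgState → Prop
  | .start => True
  | .growF b S => F.dual.Grown b S
  | .growM b S S' => F.dual.Grown b S ∧ (∀ v, F.dual.Reached b S v) ∧ T.dual.Grown (F.tet b) S'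
  | .select R out => F.GoodChoices R ∧ F.IsRecord R out
  | .traceBack R out e v γ => F.GoodChoices R ∧ F.IsRecord R out ∧ F.IsPending R out e ∧
      ∃ l, γ = l ++ [e] ∧ F.IsTreeWalk R.treeF v l (F.dual.src e)
  | .traceHome R out e v γ => F.GoodChoices R ∧ F.IsRecord R out ∧ F.IsPending R out e ∧
      ∃ l l', γ = l ++ e :: l' ∧ F.IsTreeWalk R.treeF R.base l (F.dual.src e) ∧
        F.IsTreeWalk R.treeF (F.dual.tgt e) l' v
  | .translate R out e γ w => F.GoodChoices R ∧ F.IsRecord R out ∧ F.IsPending R out e ∧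
      ∃ γ', F.IsTraced R e (γ' ++ γ) ∧ w = F.readWord R.treeM γ'
  | .done R out => F.GoodChoices R ∧ F.IsRecord R out ∧
      ∀ e, F.dual.IsGenerator R.treeF e → e ∈ out.map Prod.fst

variable {F}

theorem Inv.step {s s' : F.AlgState} (hs : F.Inv s) (h : F.Step s s') : F.Inv s' := by
  cases h with
  | basepoint b => exact .nil
  | growF d h h' => exact .snoc hs h h'
  | grownF h => exact ⟨hs, h, .nil⟩
  | growM d h h' => exact ⟨hs.1, hs.2.1, .snoc hs.2.2 h h'⟩
  | grownM h => exact ⟨⟨hs.1, hs.2.1, hs.2.2, h⟩, by simp [IsRecord]⟩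
  | select e h h' => exact ⟨hs.1, hs.2, ⟨h, h'⟩, [], rfl, .nil _ _⟩
  | back d h h' =>
    obtain ⟨h1, h2, h3, l, rfl, h4⟩ := hs
    exact ⟨h1, h2, h3, d :: l, rfl, h4.cons h⟩
  | turn =>
    obtain ⟨h1, h2, h3, l, rfl, h4⟩ := hs
    exact ⟨h1, h2, h3, l, [], rfl, h4, .nil _ _⟩
  | home d h h' =>
    obtain ⟨h1, h2, h3, l, l', rfl, h4, h5⟩ := hs
    exact ⟨h1, h2, h3, l, l' ++ [F.dual.rev d], by simp, h4, h5.snoc_rev h⟩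
  | closed =>
    obtain ⟨h1, h2, h3, h4⟩ := hs
    exact ⟨h1, h2, h3, [], h4, rfl⟩
  | @skip R out e d γ w h =>
    obtain ⟨h1, h2, h3, γ', h4, rfl⟩ := hs
    refine ⟨h1, h2, h3, γ' ++ [d], by simpa using h4, ?_⟩
    rw [readWord_append]
    simp [readWord, h]
  | @letter R out e d γ w h =>
    obtain ⟨h1, h2, h3, γ', h4, rfl⟩ := hs
    refine ⟨h1, h2, h3, γ' ++ [d], by simpa using h4, ?_⟩
    rw [readWord_append]
    simp [readWord, h]
  | @record R out e w =>
    obtain ⟨h1, h2, h3, γ', h4, rfl⟩ := hs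
    rw [List.append_nil] at h4
    refine ⟨h1, ?_, fun p hp => ?_⟩
    · rw [List.map_append, List.nodup_append]
      refine ⟨h2.1, by simp, fun a ha b hb => ?_⟩
      simp only [List.map_cons, List.map_nil, List.mem_singleton] at hb
      rintro rfl
      exact h3.2 (hb ▸ ha)
    · rw [List.mem_append, List.mem_singleton] at hp
      rcases hp with hp | rfl
      · exact h2.2 p hp
      · exact ⟨h3.1, γ', h4, rfl⟩
  | finish h => exact ⟨hs.1, hs.2, h⟩

theorem inv_of_reachable {s : F.AlgState} (h : Relation.ReflTransGen F.Step .start s) :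
    F.Inv s := by
  induction h with
  | refl => trivial
  | tail _ h ih => exact ih.step h

theorem exists_step (hF : F.dual.Connected) (hM : T.dual.Connected) (hm : Nonempty (Fin F.m))
    (s : F.AlgState) (hs : F.Inv s) : (∃ s', F.Step s s') ∨ ∃ R out, s = .done R out := by
  have up : ∀ {R : Choices (Fin F.m) F.Dart (Fin T.n × Fin 4)}, F.GoodChoices R → ∀ v,
      v ≠ R.base → ∃ d ∈ R.treeF, F.dual.tgt d = v := fun hR v hv =>
    (hR.reachedF v).resolve_left hv
  cases s with
  | start => exact .inl ⟨_, .basepoint hm.some⟩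
  | growF b S =>
    by_cases h : ∀ v, F.dual.Reached b S v
    · exact .inl ⟨_, .grownF h⟩
    · obtain ⟨d, h1, h2⟩ := hF.exists_dart_leaving h
      exact .inl ⟨_, .growF d h1 h2⟩
  | growM b S S' =>
    by_cases h : ∀ v, T.dual.Reached (F.tet b) S' v
    · exact .inl ⟨_, .grownM h⟩
    · obtain ⟨d, h1, h2⟩ := hM.exists_dart_leaving h
      exact .inl ⟨_, .growM d h1 h2⟩
  | select R out =>
    by_cases h : ∀ e, F.dual.IsGenerator R.treeF e → e ∈ out.map Prod.fst
    · exact .inl ⟨_, .finish h⟩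
    · push Not at h
      obtain ⟨e, h1, h2⟩ := h
      exact .inl ⟨_, .select e h1 h2⟩
  | traceBack R out e v γ =>
    by_cases hv : v = R.base
    · subst hv; exact .inl ⟨_, .turn⟩
    · obtain ⟨d, hd, rfl⟩ := up hs.1 v hv
      exact .inl ⟨_, .back d hd hv⟩
  | traceHome R out e v γ =>
    by_cases hv : v = R.base
    · subst hv; exact .inl ⟨_, .closed⟩
    · obtain ⟨d, hd, rfl⟩ := up hs.1 v hv
      exact .inl ⟨_, .home d hd hv⟩
  | translate R out e γ w =>
    cases γ with
    | nil => exact .inl ⟨_, .record⟩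
    | cons d γ =>
      by_cases h : T.dual.InTree R.treeM (F.toDart d)
      · exact .inl ⟨_, .skip h⟩
      · exact .inl ⟨_, .letter h⟩
  | done R out => exact .inr ⟨R, out, rfl⟩

open Classical in
/-- A function on the disks that decreases towards the root of the tree. -/
noncomputable def depth (S : List F.Dart) : Fin F.m → ℕ :=
  if h : ∃ φ : Fin F.m → ℕ, ∀ d ∈ S, φ (F.dual.src d) < φ (F.dual.tgt d) then h.choose
  else fun _ => 0

theorem depth_lt {b : Fin F.m} {S : List F.Dart} (hS : F.dual.Grown b S) {d : F.Dart}
    (hd : d ∈ S) : depth S (F.dual.src d) < depth S (F.dual.tgt d) := by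
  have h := hS.exists_depth
  rw [depth, dif_pos h]
  exact h.choose_spec d hd

/-- The number of vertices that a tree has not reached. -/
noncomputable def unreached {V D : Type} (G : DualGraph V D) (r : V) (S : List D) : ℕ :=
  {v | ¬ G.Reached r S v}.ncard

theorem unreached_snoc_lt {V D : Type} [Finite V] {G : DualGraph V D} {r : V} {S : List D} {d : D}
    (h : ¬ G.Reached r S (G.tgt d)) : unreached G r (S ++ [d]) < unreached G r S := by
  unfold unreached
  refine Set.ncard_lt_ncard (Set.ssubset_iff_subset_ne.2 ⟨fun v hv h' => ?_, fun h' => ?_⟩)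
    (Set.toFinite _)
  · exact hv (DualGraph.reached_snoc.2 (.inl h'))
  · have h1 : G.tgt d ∈ {v | ¬ G.Reached r S v} := h
    rw [← h'] at h1
    exact h1 (DualGraph.reached_snoc.2 (.inr rfl))

/-- The number of generators that remain to be treated. -/
noncomputable def remaining (R : Choices (Fin F.m) F.Dart (Fin T.n × Fin 4))
    (out : List (F.Dart × Word (Fin T.n × Fin 4))) : ℕ :=
  {e | F.IsPending R out e}.ncard

theorem remaining_snoc_lt {R : Choices (Fin F.m) F.Dart (Fin T.n × Fin 4)}
    {out : List (F.Dart × Word (Fin T.n × Fin 4))} {e : F.Dart} (h : F.IsPending R out e)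
    (w : Word (Fin T.n × Fin 4)) : remaining R (out ++ [(e, w)]) < remaining R out := by
  unfold remaining
  refine Set.ncard_lt_ncard
    (Set.ssubset_iff_subset_ne.2 ⟨fun e' he' => ⟨he'.1, fun h' => he'.2 ?_⟩, fun h' => ?_⟩)
    (Set.toFinite _)
  · rw [List.map_append]
    exact List.mem_append_left _ h'
  · have h1 : e ∈ {e | F.IsPending R out e} := h
    rw [← h'] at h1
    exact h1.2 (by simp)

/-- A quantity that decreases in each step of the algorithm. -/
noncomputable def height : F.AlgState → ℕ ×ₗ ℕ ×ₗ ℕ ×ₗ ℕ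
  | .start => toLex (3, toLex (0, toLex (0, 0)))
  | .growF b S => toLex (2, toLex (unreached F.dual b S, toLex (0, 0)))
  | .growM b _ S' => toLex (1, toLex (unreached T.dual (F.tet b) S', toLex (0, 0)))
  | .select R out => toLex (0, toLex (2 * remaining R out + 1, toLex (0, 0)))
  | .traceBack R out _ v _ => toLex (0, toLex (2 * remaining R out, toLex (2, depth R.treeF v)))
  | .traceHome R out _ v _ => toLex (0, toLex (2 * remaining R out, toLex (1, depth R.treeF v)))
  | .translate R out _ γ _ => toLex (0, toLex (2 * remaining R out, toLex (0, γ.length)))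
  | .done _ _ => toLex (0, toLex (0, toLex (0, 0)))

theorem height_lt {s s' : F.AlgState} (hs : F.Inv s) (h : F.Step s s') :
    height s' < height s := by
  cases h with
  | growF d h h' => simp [height, Prod.Lex.toLex_lt_toLex, unreached_snoc_lt h']
  | growM d h h' => simp [height, Prod.Lex.toLex_lt_toLex, unreached_snoc_lt h']
  | back d h h' => simp [height, Prod.Lex.toLex_lt_toLex, depth_lt hs.1.grownF h]
  | home d h h' => simp [height, Prod.Lex.toLex_lt_toLex, depth_lt hs.1.grownF h]
  | @record R out e w =>
    have := remaining_snoc_lt hs.2.2.1 w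
    simp [height, Prod.Lex.toLex_lt_toLex]
    omega
  | _ => simp [height, Prod.Lex.toLex_lt_toLex]

theorem no_infinite_run :
    ¬ ∃ s : ℕ → F.AlgState, s 0 = .start ∧ ∀ k, F.Step (s k) (s (k + 1)) := by
  rintro ⟨s, h0, hs⟩
  have inv : ∀ k, F.Inv (s k) := by
    intro k
    induction k with
    | zero => rw [h0]; trivial
    | succ k ih => exact ih.step (hs k)
  exact not_strictAnti_of_wellFoundedLT (fun k => height (s k))
    (strictAnti_nat_of_succ_lt fun k => height_lt (inv k) (hs k))

end Algorithm

end NormalCells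

open CategoryTheory Topology MulOpposite

open scoped unitInterval

/-! ### Classes of paths -/

section Classes

variable {X Y : Type} [TopologicalSpace X] [TopologicalSpace Y]

/-- The homotopy class of a path, as a morphism of the fundamental groupoid. -/
def cls {x y : X} (p : Path x y) : FundamentalGroupoid.mk x ⟶ FundamentalGroupoid.mk y :=
  Path.Homotopic.Quotient.mk p

theorem cls_eq_of_homotopic {x y : X} {p q : Path x y} (h : p.Homotopic q) : cls p = cls q :=
  Quotient.sound h

theorem cls_refl (x : X) : cls (Path.refl x) = 𝟙 _ := rfl

theorem cls_trans {x y z : X} (p : Path x y) (q : Path y z) :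
    cls (p.trans q) = cls p ≫ cls q := rfl

theorem cls_symm {x y : X} (p : Path x y) : cls p.symm = inv (cls p) := by
  rw [← Groupoid.inv_eq_inv]; rfl

theorem cls_cast {x y x' y' : X} (p : Path x y) (hx : x' = x) (hy : y' = y) :
    cls (p.cast hx hy) = eqToHom (congrArg _ hx) ≫ cls p ≫ eqToHom (congrArg _ hy.symm) := by
  subst hx hy; simp

theorem cls_comp_eqToHom {x y x' y' : X} (p : Path x y) (q : Path x' y') (hx : x = x')
    (hy : y = y') (h : ∀ t, p t = q t) :
    cls p ≫ eqToHom (congrArg _ hy) = eqToHom (congrArg _ hx) ≫ cls q := by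
  subst hx hy
  have : p = q := Path.ext (funext h)
  simp [this]

theorem fundamentalGroup_mul_def {x : X} (p q : FundamentalGroup X x) : p * q = q ≫ p := rfl

theorem fundamentalGroup_inv_def {x : X} (p : FundamentalGroup X x) : p⁻¹ = inv p := by
  rw [← Groupoid.inv_eq_inv]; rfl

/-- The class of the image of a straight path in a convex set. -/
noncomputable def seg {C : Set (Fin 4 → ℝ)} (hC : Convex ℝ C) {φ : C → X} (hφ : Continuous φ)
    (x y : C) : FundamentalGroupoid.mk (φ x) ⟶ FundamentalGroupoid.mk (φ y) :=
  cls ((segIn hC x.2 y.2).map hφ)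

theorem cls_map_of_convex {C : Set (Fin 4 → ℝ)} (hC : Convex ℝ C) {φ : C → X}
    (hφ : Continuous φ) {x y : C} (p q : Path x y) : cls (p.map hφ) = cls (q.map hφ) := by
  have := hC.contractibleSpace ⟨_, x.2⟩
  exact cls_eq_of_homotopic
    ((SimplyConnectedSpace.paths_homotopic p q).map (⟨φ, hφ⟩ : C(C, X)))

theorem seg_trans {C : Set (Fin 4 → ℝ)} (hC : Convex ℝ C) {φ : C → X} (hφ : Continuous φ)
    (x y z : C) : seg hC hφ x y ≫ seg hC hφ y z = seg hC hφ x z := by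
  unfold seg
  rw [← cls_trans, ← Path.map_trans]
  exact cls_map_of_convex hC hφ _ _

theorem seg_self {C : Set (Fin 4 → ℝ)} (hC : Convex ℝ C) {φ : C → X} (hφ : Continuous φ)
    (x : C) : seg hC hφ x x = 𝟙 _ := by
  have := hC.contractibleSpace ⟨_, x.2⟩
  exact cls_map_of_convex hC hφ _ (Path.refl x)

theorem inv_seg {C : Set (Fin 4 → ℝ)} (hC : Convex ℝ C) {φ : C → X} (hφ : Continuous φ)
    (x y : C) : inv (seg hC hφ x y) = seg hC hφ y x := by
  rw [IsIso.inv_eq_of_hom_inv_id]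
  rw [seg_trans, seg_self]

/-- Two straight paths in convex sets that agree in `X` can be interchanged. -/
theorem seg_comp_eqToHom_inv_seg {C C' : Set (Fin 4 → ℝ)} (hC : Convex ℝ C) (hC' : Convex ℝ C')
    {φ : C → X} {φ' : C' → X} (hφ : Continuous φ) (hφ' : Continuous φ') {x y : C} {x' y' : C'}
    (h : ∀ t : I, φ (segIn hC x.2 y.2 t) = φ' (segIn hC' x'.2 y'.2 t)) (hx : φ x = φ' x')
    (hy : φ y = φ' y') (z : C) (z' : C') :
    seg hC hφ z x ≫ eqToHom (congrArg _ hx) ≫ inv (seg hC' hφ' z' x') =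
      seg hC hφ z y ≫ eqToHom (congrArg _ hy) ≫ inv (seg hC' hφ' z' y') := by
  have key : seg hC hφ x y ≫ eqToHom (congrArg _ hy) =
      eqToHom (congrArg _ hx) ≫ seg hC' hφ' x' y' := cls_comp_eqToHom _ _ hx hy h
  rw [← seg_trans hC hφ z x y, Category.assoc, reassoc_of% key, inv_seg, inv_seg, seg_trans]

end Classes

/-! ### Realisations of dual graphs -/

/-- A realisation of a dual graph in a space: points for the vertices and for the midpoints of the
edges, and paths for the half-edges. -/
structure Realization {V D : Type} (G : DualGraph V D) (X : Type) [TopologicalSpace X] where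
  pos : V → X
  mid : D → X
  half : ∀ d, Path (pos (G.src d)) (mid d)
  mid_rev : ∀ d, mid d = mid (G.rev d)

namespace Realization

variable {V D : Type} {G : DualGraph V D} {X Y : Type} [TopologicalSpace X] [TopologicalSpace Y]
  (R : Realization G X)

/-- The path of a dart. -/
noncomputable def edge (d : D) : Path (R.pos (G.src d)) (R.pos (G.tgt d)) :=
  (R.half d).trans ((R.half (G.rev d)).symm.cast (R.mid_rev d) rfl)

/-- The image of a realisation under a continuous map. -/
def map (f : C(X, Y)) : Realization G Y where
  pos v := f (R.pos v)
  mid d := f (R.mid d)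
  half d := (R.half d).map f.continuous
  mid_rev d := congrArg f (R.mid_rev d)

theorem map_edge (f : C(X, Y)) (d : D) :
    (R.map f).edge d = (R.edge d).map f.continuous := by
  unfold edge map
  rw [Path.map_trans]
  rfl

theorem map_path (f : C(X, Y)) {u v : V} (p : G.Walk u v) :
    p.path (R.map f).edge = (p.path R.edge).map f.continuous := by
  induction p with
  | nil v => ext; rfl
  | cons d p ih =>
    rw [DualGraph.Walk.path, DualGraph.Walk.path, ih, Path.map_trans, map_edge]
    rfl

theorem cls_edge (d : D) : cls (R.edge d) =
    cls (R.half d) ≫ eqToHom (congrArg _ (R.mid_rev d)) ≫ inv (cls (R.half (G.rev d))) := by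
  have key : ∀ {x y z z' : X} (p : Path x z) (q : Path y z') (h : z = z'),
      cls (p.trans (q.symm.cast h rfl)) = cls p ≫ eqToHom (congrArg _ h) ≫ inv (cls q) := by
    intro x y z z' p q h
    rw [cls_trans, cls_cast, cls_symm]
    simp
  exact key _ _ _

variable {x₀ : X} (K : ∀ v, FundamentalGroupoid.mk x₀ ⟶ FundamentalGroupoid.mk (R.pos v))

/-- The loop of a dart, for given classes of paths from the basepoint to the vertices. -/
noncomputable def gen (d : D) : FundamentalGroup X x₀ :=
  K (G.src d) ≫ cls (R.edge d) ≫ inv (K (G.tgt d))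

theorem gen_eq (d : D) : R.gen K d = K (G.src d) ≫ cls (R.half d) ≫
    eqToHom (congrArg _ (R.mid_rev d)) ≫ inv (cls (R.half (G.rev d))) ≫
      inv (K (G.src (G.rev d))) :=
  (congrArg (fun z => K (G.src d) ≫ z ≫ inv (K (G.src (G.rev d)))) (R.cls_edge d)).trans
    (by simp)

theorem gen_rev (d : D) : R.gen K (G.rev d) = (R.gen K d)⁻¹ := by
  have key : ∀ d' (h : d' = d), inv (cls (R.half d')) ≫ inv (K (G.src d')) =
      eqToHom (by rw [h]) ≫ inv (cls (R.half d)) ≫ inv (K (G.src d)) := by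
    rintro d' rfl; simp
  rw [fundamentalGroup_inv_def, gen_eq, gen_eq, key _ (G.rev_rev d)]
  simp

theorem unop_prod_cons (g : D → FundamentalGroup X x₀) (d : D) (l : List D) :
    unop (((d :: l).map fun d => op (g d)).prod) =
      g d ≫ unop ((l.map fun d => op (g d)).prod) := by
  rw [List.map_cons, List.prod_cons]
  rfl

theorem cls_path {u v : V} (p : G.Walk u v) :
    K u ≫ cls (p.path R.edge) ≫ inv (K v) =
      unop ((p.darts.map fun d => op (R.gen K d)).prod) := by
  induction p with
  | nil v =>
    simp only [DualGraph.Walk.path, cls_refl, DualGraph.Walk.darts]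
    simp
  | cons d p ih =>
    rw [DualGraph.Walk.darts, unop_prod_cons, ← ih, DualGraph.Walk.path, cls_trans, gen]
    simp

/-! The classes of paths given by a spanning tree. -/

variable {S : List D} (hS : G.IsSpanningTree S) (r : V)
  (τ : FundamentalGroupoid.mk x₀ ⟶ FundamentalGroupoid.mk (R.pos r))

/-- From the basepoint to the root of a tree, and on in the tree. -/
noncomputable def treeCls (v : V) : FundamentalGroupoid.mk x₀ ⟶ FundamentalGroupoid.mk (R.pos v) :=
  τ ≫ cls ((DualGraph.treeWalk hS r v).path R.edge)

theorem treeCls_root : R.treeCls hS r τ r = τ := by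
  rw [treeCls, DualGraph.treeWalk_self]
  exact Category.comp_id _

theorem op_gen_rev (d : D) : op (R.gen K (G.rev d)) = (op (R.gen K d))⁻¹ := by
  rw [gen_rev]; rfl

theorem gen_of_inTree {d : D} (hd : G.InTree S d) : R.gen (R.treeCls hS r τ) d = 1 := by
  have key : ∀ v, ((DualGraph.treeWalk hS r v).darts.map
      fun d => op (R.gen (R.treeCls hS r τ) d)).prod = 1 := by
    intro v
    have := R.cls_path (R.treeCls hS r τ) (DualGraph.treeWalk hS r v)
    rw [treeCls_root, treeCls, ← Category.assoc, IsIso.hom_inv_id] at this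
    exact unop_injective this.symm
  have h := hS.prod_eq (g := fun d => op (R.gen (R.treeCls hS r τ) d))
    (R.op_gen_rev (R.treeCls hS r τ))
    ((DualGraph.treeWalk hS r (G.src d)).isWalk_darts.append (DualGraph.isWalk_singleton d))
    (fun e he => by
      rw [List.mem_append, List.mem_singleton] at he
      rcases he with he | rfl
      · exact DualGraph.treeWalk_inTree hS _ _ e he
      · exact hd)
    (DualGraph.treeWalk hS r (G.tgt d)).isWalk_darts (DualGraph.treeWalk_inTree hS _ _)
  rw [List.map_append, List.prod_append, key, key] at h
  simpa using h

theorem prod_gen_of_inTree {l : List D} (h : ∀ d ∈ l, G.InTree S d) :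
    (l.map fun d => op (R.gen (R.treeCls hS r τ) d)).prod = 1 := by
  refine List.prod_eq_one fun x hx => ?_
  obtain ⟨d, hd, rfl⟩ := List.mem_map.1 hx
  rw [R.gen_of_inTree hS r τ (h d hd)]
  rfl

theorem cls_treeLoop (d : D) :
    τ ≫ cls ((DualGraph.treeLoop hS r d).path R.edge) ≫ inv τ =
      R.gen (R.treeCls hS r τ) d := by
  have h := R.cls_path (R.treeCls hS r τ) (DualGraph.treeLoop hS r d)
  rw [treeCls_root, DualGraph.treeLoop_darts, List.map_append, List.prod_append, List.map_cons,
    List.prod_cons, R.prod_gen_of_inTree hS r τ (DualGraph.treeWalk_inTree hS _ _),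
    R.prod_gen_of_inTree hS r τ (DualGraph.treeWalk_inTree hS _ _)] at h
  rw [h]
  simp

theorem gen_mem_closure (d : D) : R.gen (R.treeCls hS r τ) d ∈
    Subgroup.closure {g | ∃ d, G.IsGenerator S d ∧ R.gen (R.treeCls hS r τ) d = g} := by
  by_cases h : G.InTree S d
  · rw [R.gen_of_inTree hS r τ h]
    exact one_mem _
  · cases hp : G.positive d with
    | true => exact Subgroup.subset_closure ⟨d, ⟨hp, h⟩, rfl⟩
    | false =>
      rw [← G.rev_rev d, gen_rev]
      refine inv_mem (Subgroup.subset_closure ⟨_, ⟨?_, fun h' => h ?_⟩, rfl⟩)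
      · rw [G.positive_rev, hp]; rfl
      · rw [← G.rev_rev d]; exact h'.rev

/-- The value of a word read off from a list of darts. -/
theorem evalWord_flatMap {D' : Type} (f : D' → D) (l : List D') [DecidablePred (G.InTree S)] :
    evalWord (R.gen (R.treeCls hS r τ))
        (l.flatMap fun d => if G.InTree S (f d) then [] else [G.letter (f d)]) =
      unop ((l.map fun d => op (R.gen (R.treeCls hS r τ) (f d))).prod) := by
  induction l with
  | nil => rfl
  | cons d l ih =>
    rw [List.flatMap_cons, List.map_cons, List.prod_cons, unop_mul, unop_op]
    by_cases h : G.InTree S (f d)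
    · rw [if_pos h, R.gen_of_inTree hS r τ h, mul_one, ← ih]
      rfl
    · rw [if_neg h, ← ih]
      cases hp : G.positive (f d) with
      | true => simp [DualGraph.letter, hp, evalWord]
      | false => simp [DualGraph.letter, hp, evalWord, gen_rev]

end Realization

/-! ### Generation of fundamental groups -/

/-- A path in a neighbourhood that contracts to its starting point is homotopic to the track of its
endpoint. -/
theorem cls_eq_of_contraction {X : Type} [TopologicalSpace X] {U : Set X} {H : U × I → X}
    (hH : Continuous H) {q u : X} (γ : Path q u) (hγ : ∀ t, γ t ∈ U)
    (h0 : ∀ u, H (u, 0) = q) (h1 : ∀ u, H (u, 1) = u) (hq : ∀ h t, H (⟨q, h⟩, t) = q)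
    (δ : Path q u) (hδ : ∀ h t, δ t = H (⟨u, h⟩, t)) : cls γ = cls δ := by
  have cont : ∀ f : I × I → I × I, Continuous f →
      Continuous fun z => H (⟨γ (f z).1, hγ _⟩, (f z).2) := by
    intro f hf
    fun_prop
  let diag : Path q u :=
    ⟨⟨fun s => H (⟨γ s, hγ s⟩, s), by
      exact (cont (fun z => (z.1, z.1)) (by fun_prop)).comp (f := fun s : I => (s, (0 : I)))
        (by fun_prop)⟩, by simp [hq], by simp [h1]⟩
  have e1 : γ.Homotopic diag := ⟨{
    toFun := fun z => H (⟨γ z.2, hγ _⟩, unitInterval.symm (z.1 * unitInterval.symm z.2))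
    continuous_toFun :=
      cont (fun z => (z.2, unitInterval.symm (z.1 * unitInterval.symm z.2))) (by fun_prop)
    map_zero_left := fun s => by simp [h1]
    map_one_left := fun s => by simp [diag]
    prop' := by
      rintro t s (rfl | rfl)
      · simp [hq]
      · simp [h1] }⟩
  have e2 : diag.Homotopic δ := ⟨{
    toFun := fun z =>
      H (⟨γ (unitInterval.symm (unitInterval.symm z.1 * unitInterval.symm z.2)), hγ _⟩, z.2)
    continuous_toFun :=
      cont (fun z => (unitInterval.symm (unitInterval.symm z.1 * unitInterval.symm z.2), z.2))
        (by fun_prop)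
    map_zero_left := fun s => by simp [diag]
    map_one_left := fun s => by simp [hδ (by simpa using hγ 1) s]
    prop' := by
      rintro t s (rfl | rfl)
      · simp [h0]
      · simp [h1] }⟩
  exact cls_eq_of_homotopic (e1.trans e2)

/-- A subgroup of the fundamental group is the whole group if it contains, relative to suitable
classes of paths from the basepoint, all sufficiently short paths. -/
theorem eq_top_of_locally_mem {X : Type} [TopologicalSpace X] {x₀ : X}
    (N : Subgroup (FundamentalGroup X x₀))
    (A : ∀ q : X, Set (FundamentalGroupoid.mk x₀ ⟶ FundamentalGroupoid.mk q))
    (hA : ∀ q, (A q).Nonempty)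
    (hN : ∀ q, ∀ a ∈ A q, ∀ b ∈ A q, (a ≫ inv b : FundamentalGroup X x₀) ∈ N)
    (hloc : ∀ q, ∃ U ∈ 𝓝 q, ∀ u, ∀ γ : Path q u, (∀ t, γ t ∈ U) →
      ∃ a ∈ A q, ∃ b ∈ A u, (a ≫ cls γ ≫ inv b : FundamentalGroup X x₀) ∈ N)
    (h1 : 𝟙 _ ∈ A x₀) : N = ⊤ := by
  choose k hk using hA
  let good {p q : X} (γ : FundamentalGroupoid.mk p ⟶ FundamentalGroupoid.mk q) : Prop :=
    (k p ≫ γ ≫ inv (k q) : FundamentalGroup X x₀) ∈ N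
  have good_trans : ∀ {p q r : X} (γ : FundamentalGroupoid.mk p ⟶ FundamentalGroupoid.mk q)
      (δ : FundamentalGroupoid.mk q ⟶ FundamentalGroupoid.mk r), good γ → good δ →
      good (γ ≫ δ) := by
    intro p q r γ δ h h'
    have := N.mul_mem h' h
    rw [fundamentalGroup_mul_def] at this
    simpa [good] using this
  have good_inv : ∀ {p q : X} (γ : FundamentalGroupoid.mk p ⟶ FundamentalGroupoid.mk q),
      good γ → good (inv γ) := by
    intro p q γ h
    have := N.inv_mem h
    rw [fundamentalGroup_inv_def] at this
    simpa [good] using this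
  have good_loc : ∀ q, ∃ U ∈ 𝓝 q, ∀ u, ∀ γ : Path q u, (∀ t, γ t ∈ U) → good (cls γ) := by
    intro q
    obtain ⟨U, hU, h⟩ := hloc q
    refine ⟨U, hU, fun u γ hγ => ?_⟩
    obtain ⟨a, ha, b, hb, hab⟩ := h u γ hγ
    have := N.mul_mem (N.mul_mem (hN u b hb _ (hk u)) hab) (hN q _ (hk q) a ha)
    simp only [fundamentalGroup_mul_def] at this
    simpa [good] using this
  have good_all : ∀ {p q : X} (γ : Path p q), good (cls γ) := by
    intro p q γ
    have h : ∀ s t : I, good (cls (γ.subpath s t)) := by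
      refine PreconnectedSpace.induction₂' _ (fun s => ?_) ⟨fun s t r h h' => ?_⟩
      · obtain ⟨U, hU, h⟩ := good_loc (γ s)
        obtain ⟨ε, hε, hV⟩ := Metric.mem_nhds_iff.1 (γ.continuous.continuousAt hU)
        filter_upwards [Metric.ball_mem_nhds s hε] with t ht
        have hst : good (cls (γ.subpath s t)) := by
          refine h _ _ fun r => ?_
          have : γ.subpath s t r ∈ Set.range (γ.subpath s t) := ⟨r, rfl⟩
          rw [Path.range_subpath] at this
          obtain ⟨r', hr', h'⟩ := this
          rw [← h']
          refine hV (Metric.mem_ball.2 (lt_of_le_of_lt ?_ (Metric.mem_ball.1 ht)))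
          rw [dist_comm, dist_comm t s]
          exact Real.dist_left_le_of_mem_uIcc (Set.mem_uIcc.2 (Set.mem_uIcc.1 hr'))
        refine ⟨hst, ?_⟩
        rw [← Path.symm_subpath, cls_symm]
        exact good_inv _ hst
      · rw [← cls_eq_of_homotopic ⟨Path.Homotopy.subpathTransSubpath γ s t r⟩, cls_trans]
        exact good_trans _ _ h h'
    have h01 := h 0 1
    rw [Path.subpath_zero_one, cls_cast] at h01
    have e0 := γ.source
    have e1 := γ.target
    have : ∀ (p' q' : X) (hp : p' = p) (hq : q' = q) (δ : FundamentalGroupoid.mk p ⟶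
        FundamentalGroupoid.mk q), good (eqToHom (congrArg FundamentalGroupoid.mk hp) ≫ δ ≫
        eqToHom (congrArg FundamentalGroupoid.mk hq.symm)) → good δ := by
      rintro _ _ rfl rfl δ h
      simpa using h
    exact this _ _ e0 e1 _ h01
  refine (Subgroup.eq_top_iff' N).2 fun g => ?_
  induction g using Path.Homotopic.Quotient.ind with | mk γ =>
  have h := good_all γ
  have h2 := hN x₀ _ h1 _ (hk x₀)
  have := N.mul_mem (N.mul_mem (N.inv_mem h2) h) h2
  rw [fundamentalGroup_inv_def] at this
  simp only [fundamentalGroup_mul_def] at this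
  simpa [cls] using this

/-- Vertices of a graph are connected if they label the points of a connected space such that nearby
points have a common label, and labels of the same point are connected. -/
theorem connected_of_labels {V D X : Type} [TopologicalSpace X] [PreconnectedSpace X]
    {G : DualGraph V D} (L : X → V → Prop) (hV : ∀ v, ∃ q, L q v)
    (hL : ∀ q v w, L q v → L q w → ∃ l, G.IsWalk v l w)
    (hloc : ∀ q, ∀ᶠ u in 𝓝 q, ∃ v, L q v ∧ L u v) : G.Connected := by
  have hne : ∀ q, ∃ v, L q v := fun q => (hloc q).self_of_nhds.imp fun _ h => h.1
  have h : ∀ q u : X, ∀ v w, L q v → L u w → ∃ l, G.IsWalk v l w := by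
    refine PreconnectedSpace.induction₂' _ (fun q => ?_) ⟨fun a b c h h' v w hv hw => ?_⟩
    · filter_upwards [hloc q] with u hu
      obtain ⟨x, hx, hx'⟩ := hu
      refine ⟨fun v w hv hw => ?_, fun v w hv hw => ?_⟩
      · obtain ⟨l, hl⟩ := hL q v x hv hx
        obtain ⟨l', hl'⟩ := hL u x w hx' hw
        exact ⟨_, hl.append hl'⟩
      · obtain ⟨l, hl⟩ := hL u v x hv hx'
        obtain ⟨l', hl'⟩ := hL q x w hx hw
        exact ⟨_, hl.append hl'⟩
    · obtain ⟨x, hx⟩ := hne b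
      obtain ⟨l, hl⟩ := h v x hv hx
      obtain ⟨l', hl'⟩ := h' x w hx hw
      exact ⟨_, hl.append hl'⟩
  intro v w
  obtain ⟨q, hq⟩ := hV v
  obtain ⟨u, hu⟩ := hV w
  exact h q u v w hq hu

/-! ### The manifold -/

theorem segIn_apply {s : Set (Fin 4 → ℝ)} (hs : Convex ℝ s) {x y : Fin 4 → ℝ} (hx : x ∈ s)
    (hy : y ∈ s) (t : I) (a : Fin 4) :
    (segIn hs hx hy t : Fin 4 → ℝ) a = x a + (t : ℝ) * (y a - x a) := by
  simp [segIn, AffineMap.lineMap_apply]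
  ring

theorem continuous_segIn {C : Set (Fin 4 → ℝ)} (hC : Convex ℝ C) (x : C) :
    Continuous fun z : C × I => segIn hC x.2 z.1.2 z.2 := by
  refine Continuous.subtype_mk (continuous_pi fun a => ?_) _
  have : Continuous fun z : C × I => x.1 a + (z.2 : ℝ) * (z.1.1 a - x.1 a) := by
    have h : Continuous fun z : C × I => z.1.1 a := (continuous_apply a).comp (by fun_prop)
    fun_prop
  convert this using 2 with z
  exact segIn_apply hC x.2 z.1.2 z.2 a

/-- The points `x`, `y` differ by less than `ε` in each coordinate. -/
def Near (ε : ℝ) (x y : Fin 4 → ℝ) : Prop := ∀ a, |y a - x a| < ε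

theorem relabel_mem {x : Fin 4 → ℝ} (π : Equiv.Perm (Fin 4)) (hx : x ∈ idealTet) :
    relabel π x ∈ idealTet := by
  refine ⟨⟨fun a => hx.1.1 _, ?_⟩, fun a => hx.2 _⟩
  rw [← hx.1.2]
  exact Equiv.sum_comp π.symm x

/-- The number `ε` is small compared to the nonzero coordinates of `x` and their differences. -/
def Small (x : Fin 4 → ℝ) (ε : ℝ) : Prop :=
  0 < ε ∧ (∀ a, x a ≠ 0 → ε ≤ x a) ∧ ∀ a b, x a ≠ x b → 2 * ε ≤ |x a - x b|

theorem eventually_small (x : idealTet) : ∀ᶠ ε in 𝓝[>] (0 : ℝ), Small x.1 ε := by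
  refine (eventually_mem_nhdsWithin (a := (0 : ℝ)) (s := Set.Ioi 0)).and
    (Filter.Eventually.and ?_ ?_)
  · refine Filter.eventually_all.2 fun a => ?_
    by_cases h : x.1 a = 0
    · simp [h]
    · have h' : 0 < x.1 a := lt_of_le_of_ne (x.2.1.1 a) (Ne.symm h)
      filter_upwards [eventually_nhdsWithin_of_eventually_nhds (eventually_lt_nhds h')] with ε hε _
      exact hε.le
  · refine Filter.eventually_all.2 fun a => Filter.eventually_all.2 fun b => ?_
    by_cases h : x.1 a = x.1 b
    · simp [h]
    · have h' : 0 < |x.1 a - x.1 b| / 2 := by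
        have := abs_pos.2 (sub_ne_zero.2 h)
        positivity
      filter_upwards [eventually_nhdsWithin_of_eventually_nhds (eventually_lt_nhds h')] with ε hε _
      linarith

theorem Near.eq_zero {x y : Fin 4 → ℝ} {ε : ℝ} (h : Near ε x y) (hε : Small x ε) {f : Fin 4}
    (hy : y f = 0) : x f = 0 := by
  by_contra hx
  have h1 := h f
  rw [hy, zero_sub, abs_neg] at h1
  exact absurd ((hε.2.1 f hx).trans (le_abs_self _)) h1.not_ge

theorem Small.relabel {x : Fin 4 → ℝ} {ε : ℝ} (h : Small x ε) (π : Equiv.Perm (Fin 4)) :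
    Small (relabel π x) ε :=
  ⟨h.1, fun _ => h.2.1 _, fun _ _ => h.2.2 _ _⟩

namespace IdealTriangulation

section Local

variable {T : IdealTriangulation}

variable (T) in
/-- The projection of the disjoint union of the tetrahedra to the manifold. -/
def proj (p : Fin T.n × idealTet) : T.Space := T.pt p.1 p.2

theorem isQuotientMap_proj : IsQuotientMap T.proj := isQuotientMap_quot_mk

theorem Glue.symm {p q : Fin T.n × idealTet} (h : T.Glue p q) : T.Glue q p := by
  obtain ⟨i, x⟩ := p
  obtain ⟨j, y⟩ := q
  obtain ⟨f, hf, h1, h2⟩ := h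
  simp only at hf h1 h2
  subst h1
  refine ⟨T.perm i f f, ?_, (T.nbr_nbr i f).symm, ?_⟩
  · simp [h2, relabel, hf]
  · funext a
    simp [h2, relabel, T.perm_perm]

theorem reflTransGen_of_proj_eq {p q : Fin T.n × idealTet}
    (h : T.proj p = T.proj q) :
    Relation.ReflTransGen T.Glue p q := by
  have hsymm : Std.Symm T.Glue := ⟨fun _ _ h => h.symm⟩
  have h' : Relation.EqvGen T.Glue p q := Quot.eqvGen_exact h
  clear h
  induction h' with
  | rel _ _ h => exact .single h
  | refl _ => exact .refl
  | symm _ _ _ ih => exact Relation.ReflTransGen.stdSymm.symm _ _ ih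
  | trans _ _ _ _ _ ih ih' => exact ih.trans ih'

theorem exists_relabel {p q : Fin T.n × idealTet}
    (h : T.proj p = T.proj q) :
    ∃ π : Equiv.Perm (Fin 4), q.2.1 = relabel π p.2.1 := by
  have h' := reflTransGen_of_proj_eq h
  clear h
  induction h' with
  | refl => exact ⟨1, rfl⟩
  | tail _ h ih =>
    obtain ⟨π, hπ⟩ := ih
    obtain ⟨f, -, -, h2⟩ := h
    exact ⟨T.perm _ f * π, by rw [h2, hπ]; rfl⟩

theorem glue_segIn {i : Fin T.n} {f : Fin 4} {j : Fin T.n} (hj : j = T.nbr i f)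
    {x y x' y' : idealTet} (hx : x.1 f = 0) (hy : y.1 f = 0)
    (hx' : x'.1 = relabel (T.perm i f) x.1) (hy' : y'.1 = relabel (T.perm i f) y.1) (t : I) :
    T.pt i (segIn convex_idealTet x.2 y.2 t) = T.pt j (segIn convex_idealTet x'.2 y'.2 t) := by
  refine Quot.sound ⟨f, ?_, hj, ?_⟩
  · rw [segIn_apply, hx, hy]; simp
  · funext a
    rw [segIn_apply, hx', hy', relabel, relabel, relabel, segIn_apply]

variable (p₀ : Fin T.n × idealTet) (ε : ℝ)

/-- The point `x` of the `i`-th tetrahedron represents the point `p₀` of the manifold. -/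
def Rep (i : Fin T.n) (x : idealTet) : Prop := T.proj p₀ = T.pt i x

variable {p₀ ε}

theorem Rep.exists_relabel {i : Fin T.n} {x : idealTet} (h : Rep p₀ i x) :
    ∃ π : Equiv.Perm (Fin 4), x.1 = relabel π p₀.2.1 :=
  IdealTriangulation.exists_relabel (q := (i, x)) h

theorem Rep.small {i : Fin T.n} {x : idealTet} (h : Rep p₀ i x) (hε : Small p₀.2.1 ε) :
    Small x.1 ε := by
  obtain ⟨π, hπ⟩ := h.exists_relabel
  rw [hπ]
  exact hε.relabel π

theorem Rep.eq_of_near {i j : Fin T.n} {x x' y : idealTet} (h : Rep p₀ i x) (h' : Rep p₀ j x')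
    (hε : Small p₀.2.1 ε) (hy : Near ε x.1 y.1) (hy' : Near ε x'.1 y.1) : x = x' := by
  obtain ⟨π, hπ⟩ := h.exists_relabel
  obtain ⟨π', hπ'⟩ := h'.exists_relabel
  apply Subtype.ext
  funext a
  by_contra hne
  have h1 := hy a
  have h2 := hy' a
  have h3 : 2 * ε ≤ |x.1 a - x'.1 a| := by
    rw [hπ, hπ'] at hne ⊢
    exact hε.2.2 _ _ hne
  have h4 := abs_sub_le (x.1 a) (y.1 a) (x'.1 a)
  rw [abs_sub_comm (x.1 a) (y.1 a)] at h4
  linarith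

theorem Rep.glue {p p' : Fin T.n × idealTet} {x : idealTet} (h : Rep p₀ p.1 x)
    (hε : Small p₀.2.1 ε) (hp : Near ε x.1 p.2.1) (hg : T.Glue p p') :
    ∃ x' : idealTet, Rep p₀ p'.1 x' ∧ Near ε x'.1 p'.2.1 ∧
      ∀ t, T.pt p.1 (segIn convex_idealTet x.2 p.2.2 t) =
        T.pt p'.1 (segIn convex_idealTet x'.2 p'.2.2 t) := by
  obtain ⟨f, hf, h1, h2⟩ := hg
  have hx : x.1 f = 0 := hp.eq_zero (h.small hε) hf
  have h3 : T.pt p.1 x = T.pt p'.1 ⟨_, relabel_mem (T.perm p.1 f) x.2⟩ :=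
    Quot.sound ⟨f, hx, h1, rfl⟩
  refine ⟨⟨_, relabel_mem (T.perm p.1 f) x.2⟩, Eq.trans h h3, fun a => ?_,
    glue_segIn h1 hx hf rfl h2⟩
  rw [h2]
  exact hp _

theorem Rep.pt_segIn_eq {p p' : Fin T.n × idealTet}
    (h : T.proj p = T.proj p') {x x' : idealTet}
    (hx : Rep p₀ p.1 x) (hx' : Rep p₀ p'.1 x') (hε : Small p₀.2.1 ε) (hp : Near ε x.1 p.2.1)
    (hp' : Near ε x'.1 p'.2.1) (t : I) :
    T.pt p.1 (segIn convex_idealTet x.2 p.2.2 t) =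
      T.pt p'.1 (segIn convex_idealTet x'.2 p'.2.2 t) := by
  have h' := reflTransGen_of_proj_eq h
  clear h
  induction h' using Relation.ReflTransGen.head_induction_on generalizing x with
  | refl => rw [hx.eq_of_near hx' hε hp hp']
  | head hg _ ih =>
    obtain ⟨y, hy, hpy, h⟩ := hx.glue hε hp hg
    exact (h t).trans (ih hy hpy)

variable (p₀ ε)

/-- The points of the tetrahedra that are close to a representative of `p₀`. -/
def nearSet : Set (Fin T.n × idealTet) :=
  {p | ∃ x, Rep p₀ p.1 x ∧ Near ε x.1 p.2.1}

theorem isOpen_near (x : Fin 4 → ℝ) : IsOpen {y : idealTet | Near ε x y.1} := by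
  simp only [Near, Set.ofPred_forall]
  refine isOpen_iInter_of_finite fun a => ?_
  have : Continuous fun y : idealTet => |y.1 a - x a| := by
    have h : Continuous fun y : idealTet => y.1 a :=
      (continuous_apply a).comp continuous_subtype_val
    exact (h.sub continuous_const).abs
  exact isOpen_lt this continuous_const

theorem isOpen_near_prod (i : Fin T.n) (x : Fin 4 → ℝ) :
    IsOpen {p : Fin T.n × idealTet | p.1 = i ∧ Near ε x p.2.1} :=
  ((isOpen_discrete {i}).preimage continuous_fst).inter
    ((isOpen_near ε x).preimage continuous_snd)

theorem isOpen_nearSet : IsOpen (nearSet p₀ ε) := by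
  refine isOpen_iff_mem_nhds.2 fun p ⟨x, hx, hp⟩ => ?_
  filter_upwards [(isOpen_near_prod ε p.1 x.1).mem_nhds ⟨rfl, hp⟩] with p' hp'
  exact ⟨x, hp'.1 ▸ hx, hp'.2⟩

/-- A neighbourhood of the point of the manifold represented by `p₀`. -/
def nearImage : Set T.Space := {u | ∃ p ∈ nearSet p₀ ε, T.proj p = u}

variable {p₀ ε}

theorem proj_mem_nearImage (hε : Small p₀.2.1 ε) (p : Fin T.n × idealTet) :
    T.proj p ∈ nearImage p₀ ε ↔ p ∈ nearSet p₀ ε := by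
  refine ⟨?_, fun h => ⟨p, h, rfl⟩⟩
  rintro ⟨p', hp', h⟩
  have h' := reflTransGen_of_proj_eq h
  clear h
  induction h' with
  | refl => exact hp'
  | tail _ hg ih =>
    obtain ⟨x, hx, hp⟩ := ih
    obtain ⟨y, hy, hpy, -⟩ := hx.glue hε hp hg
    exact ⟨y, hy, hpy⟩

theorem isOpen_nearImage (hε : Small p₀.2.1 ε) : IsOpen (nearImage p₀ ε) := by
  refine isOpen_coinduced.2 ?_
  convert isOpen_nearSet p₀ ε using 1
  ext p
  exact proj_mem_nearImage hε p

theorem proj_mem_nearImage_self (hε : Small p₀.2.1 ε) : T.proj p₀ ∈ nearImage p₀ ε :=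
  ⟨p₀, ⟨p₀.2, rfl, fun a => by simpa using hε.1⟩, rfl⟩

/-- Every point of the manifold has a neighbourhood that contracts to it along straight lines. -/
theorem exists_contraction (hε : Small p₀.2.1 ε) : ∃ H : nearImage p₀ ε × I → T.Space,
    Continuous H ∧ (∀ u, H (u, 0) = T.proj p₀) ∧ (∀ u, H (u, 1) = u) ∧
      (∀ h t, H (⟨T.proj p₀, h⟩, t) = T.proj p₀) ∧ ∀ i y h, ∃ x, Rep p₀ i x ∧ Near ε x.1 y.1 ∧
        ∀ t, H (⟨T.pt i y, h⟩, t) = T.pt i (segIn convex_idealTet x.2 y.2 t) := by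
  have hrep : ∀ u : nearImage p₀ ε, ∃ p x, Rep p₀ p.1 x ∧ Near ε x.1 p.2.1 ∧
      T.proj p = u.1 := by
    rintro ⟨u, p, ⟨x, hx⟩, rfl⟩
    exact ⟨p, x, hx.1, hx.2, rfl⟩
  choose P x hx hP hPu using hrep
  let H : nearImage p₀ ε × I → T.Space := fun z =>
    T.pt (P z.1).1 (segIn convex_idealTet (x z.1).2 (P z.1).2.2 z.2)
  have key : ∀ p y h, Rep p₀ p.1 y → Near ε y.1 p.2.1 → ∀ t,
      H (⟨T.proj p, h⟩, t) = T.pt p.1 (segIn convex_idealTet y.2 p.2.2 t) :=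
    fun p y h hy hp t => Rep.pt_segIn_eq (hPu ⟨_, h⟩) (hx _) hy hε (hP _) hp t
  refine ⟨H, ?_, fun u => ?_, fun u => ?_, fun h t => ?_, fun i y h => ?_⟩
  · have hq : IsQuotientMap ((nearImage p₀ ε).restrictPreimage T.proj) :=
      isQuotientMap_proj.restrictPreimage_isOpen (isOpen_nearImage hε)
    refine hq.continuous_lift_prod_left (continuous_iff_continuousAt.2 fun z => ?_)
    obtain ⟨⟨p, hp⟩, t⟩ := z
    obtain ⟨y, hy, hpy⟩ := (proj_mem_nearImage hε p).1 hp
    have hcont : Continuous fun z : (T.proj ⁻¹' nearImage p₀ ε) × I =>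
        T.pt p.1 (segIn convex_idealTet y.2 z.1.1.2.2 z.2) :=
      (T.continuous_pt _).comp ((continuous_segIn convex_idealTet y).comp
        (f := fun z : (T.proj ⁻¹' nearImage p₀ ε) × I => (z.1.1.2, z.2)) (by fun_prop))
    refine hcont.continuousAt.congr ?_
    have hnhds : ∀ᶠ z : (T.proj ⁻¹' nearImage p₀ ε) × I in 𝓝 (⟨p, hp⟩, t),
        z.1.1.1 = p.1 ∧ Near ε y.1 z.1.1.2.1 :=
      ((continuous_subtype_val.comp continuous_fst :
        Continuous fun z : (T.proj ⁻¹' nearImage p₀ ε) × I => z.1.1).tendsto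
        (⟨p, hp⟩, t)).eventually ((isOpen_near_prod ε p.1 y.1).mem_nhds ⟨rfl, hpy⟩)
    filter_upwards [hnhds] with z hz
    obtain ⟨hz1, hz2⟩ := hz
    rw [← hz1] at hy ⊢
    exact (key _ _ _ hy hz2 _).symm
  · exact (congrArg (T.pt (P u).1) (Path.source _)).trans (hx u).symm
  · exact (congrArg (T.pt (P u).1) (Path.target _)).trans (hPu u)
  · rw [key p₀ p₀.2 h rfl fun a => by simpa using hε.1]
    have : segIn convex_idealTet p₀.2.2 p₀.2.2 t = p₀.2 := by
      apply Subtype.ext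
      funext a
      rw [segIn_apply]; simp
    rw [this]
    rfl
  · obtain ⟨y', hy', hpy⟩ := (proj_mem_nearImage hε (i, y)).1 h
    exact ⟨y', hy', hpy, key (i, y) y' h hy' hpy⟩

end Local

end IdealTriangulation

/-! ### Generators of the fundamental group of the manifold -/

/-- The class of a path in a neighbourhood that contracts to its starting point along the images of
straight lines. -/
theorem cls_eq_seg_of_contraction {X : Type} [TopologicalSpace X] {U : Set X} {H : U × I → X}
    (hH : Continuous H) {q : X} (h0 : ∀ u, H (u, 0) = q) (h1 : ∀ u, H (u, 1) = u)
    (hq : ∀ h t, H (⟨q, h⟩, t) = q) {C : Set (Fin 4 → ℝ)} (hC : Convex ℝ C) {φ : C → X}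
    (hφ : Continuous φ) {x y : C} (hx : φ x = q)
    (hy : ∀ h t, H (⟨φ y, h⟩, t) = φ (segIn hC x.2 y.2 t)) (γ : Path q (φ y))
    (hγ : ∀ t, γ t ∈ U) : cls γ = eqToHom (congrArg _ hx.symm) ≫ seg hC hφ x y := by
  subst hx
  rw [cls_eq_of_contraction hH γ hγ h0 h1 hq ((segIn hC x.2 y.2).map hφ)
    fun h t => (hy h t).symm]
  simp [seg]

section Ray

variable {X : Type} [TopologicalSpace X] {x₀ : X} {C C' : Set (Fin 4 → ℝ)} (hC : Convex ℝ C)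
  (hC' : Convex ℝ C') {φ : C → X} {φ' : C' → X} (hφ : Continuous φ) (hφ' : Continuous φ')

/-- From the basepoint to the centre of a convex set, and straight on. -/
noncomputable def rayCls {v : X} (k : FundamentalGroupoid.mk x₀ ⟶ FundamentalGroupoid.mk v) {z : C}
    (hz : v = φ z) (x : C) : FundamentalGroupoid.mk x₀ ⟶ FundamentalGroupoid.mk (φ x) :=
  k ≫ eqToHom (congrArg _ hz) ≫ seg hC hφ z x

theorem rayCls_comp_cls {v : X} (k : FundamentalGroupoid.mk x₀ ⟶ FundamentalGroupoid.mk v)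
    {z x y : C} (hz : v = φ z) (α : Path (φ x) (φ y)) (hα : ∀ t, α t = φ (segIn hC x.2 y.2 t)) :
    rayCls hC hφ k hz x ≫ cls α = rayCls hC hφ k hz y := by
  have h1 : cls α = seg hC hφ x y := congrArg cls (Path.ext (funext hα))
  rw [h1, rayCls, rayCls, Category.assoc, Category.assoc, seg_trans]

theorem rayCls_comp_eqToHom {v : X} (k : FundamentalGroupoid.mk x₀ ⟶ FundamentalGroupoid.mk v)
    {z y : C} {z' y' : C'} (hz : v = φ z) (hz' : v = φ' z') (hy : φ y = φ' y')
    (h : ∀ t, φ (segIn hC z.2 y.2 t) = φ' (segIn hC' z'.2 y'.2 t)) :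
    rayCls hC hφ k hz y ≫ eqToHom (congrArg _ hy) = rayCls hC' hφ' k hz' y' := by
  subst hz
  have key : seg hC hφ z y ≫ eqToHom (congrArg _ hy) =
      eqToHom (congrArg _ hz') ≫ seg hC' hφ' z' y' := cls_comp_eqToHom _ _ hz' hy h
  simp only [rayCls, eqToHom_refl, Category.id_comp, Category.assoc, key]

theorem rayCls_seg_self (x z : C) : rayCls hC hφ (seg hC hφ x z) rfl x = 𝟙 _ := by
  simp [rayCls, seg_trans, seg_self]

/-- The loop of an edge that crosses from one convex set to another can cross at any other common
point. -/
theorem rayCls_comp_inv_rayCls {v v' m m' : X}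
    (k : FundamentalGroupoid.mk x₀ ⟶ FundamentalGroupoid.mk v)
    (k' : FundamentalGroupoid.mk x₀ ⟶ FundamentalGroupoid.mk v') {z x y : C} {z' x' y' : C'}
    (hz : v = φ z) (hz' : v' = φ' z') (hx : m = φ x) (hx' : m' = φ' x') (hm : m = m')
    (hy : φ y = φ' y') (α : Path v m) (β : Path v' m') (hα : ∀ t, α t = φ (segIn hC z.2 x.2 t))
    (hβ : ∀ t, β t = φ' (segIn hC' z'.2 x'.2 t))
    (h : ∀ t : I, φ (segIn hC x.2 y.2 t) = φ' (segIn hC' x'.2 y'.2 t)) :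
    rayCls hC hφ k hz y ≫ eqToHom (congrArg _ hy) ≫ inv (rayCls hC' hφ' k' hz' y') =
      k ≫ cls α ≫ eqToHom (congrArg _ hm) ≫ inv (cls β) ≫ inv k' := by
  subst hz hz' hx hx'
  have key := seg_comp_eqToHom_inv_seg hC hC' hφ hφ' h hm hy z z'
  have h1 : cls α = seg hC hφ z x := congrArg cls (Path.ext (funext hα))
  have h2 : cls β = seg hC' hφ' z' x' := congrArg cls (Path.ext (funext hβ))
  rw [h1, h2]
  simp only [rayCls, eqToHom_refl, Category.id_comp, IsIso.inv_comp, Category.assoc]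
  simpa only [Category.assoc] using congrArg (fun a => k ≫ a ≫ inv k') key.symm

theorem rayCls_comp_cls_of_contraction {U : Set X} {H : U × I → X}
    (hH : Continuous H) {q : X} (h0 : ∀ u, H (u, 0) = q) (h1 : ∀ u, H (u, 1) = u)
    (hq : ∀ h t, H (⟨q, h⟩, t) = q) {v : X}
    (k : FundamentalGroupoid.mk x₀ ⟶ FundamentalGroupoid.mk v) {z x y : C} (hz : v = φ z)
    (hx : φ x = q) (hy : ∀ h t, H (⟨φ y, h⟩, t) = φ (segIn hC x.2 y.2 t)) (γ : Path q (φ y))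
    (hγ : ∀ t, γ t ∈ U) :
    ((rayCls hC hφ k hz x ≫ eqToHom (congrArg _ hx)) ≫ cls γ ≫
      inv (rayCls hC hφ k hz y ≫ 𝟙 _) : FundamentalGroup X x₀) = 1 := by
  subst hx hz
  rw [cls_eq_seg_of_contraction hH h0 h1 hq hC hφ rfl hy γ hγ]
  simp [rayCls, inv_seg, seg_self, reassoc_of% seg_trans]

end Ray

namespace IdealTriangulation

section Generation

variable {T : IdealTriangulation}

theorem isWalk_of_proj_eq {p p' : Fin T.n × idealTet} (h : T.proj p = T.proj p') :
    ∃ l, T.dual.IsWalk p.1 l p'.1 := by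
  induction reflTransGen_of_proj_eq h using Relation.ReflTransGen.head_induction_on with
  | refl => exact ⟨[], rfl⟩
  | @head p r hg hr ih =>
    obtain ⟨f, -, h1, -⟩ := id hg
    obtain ⟨l, hl⟩ := ih ((Quot.sound hg : T.proj p = T.proj r).symm.trans h)
    exact ⟨(p.1, f) :: l, rfl, (show r.1 = T.dual.tgt (p.1, f) from h1) ▸ hl⟩

theorem exists_pt_eq (q : T.Space) : ∃ i x, T.pt i x = q := by
  obtain ⟨p, rfl⟩ := Quot.exists_rep q
  exact ⟨p.1, p.2, rfl⟩

theorem exists_small (p : Fin T.n × idealTet) : ∃ ε, Small p.2.1 ε :=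
  (eventually_small p.2).exists

theorem dual_connected (hM : ConnectedSpace T.Space) : T.dual.Connected := by
  refine connected_of_labels (X := T.Space) (fun q i => ∃ x, T.pt i x = q)
    (fun i => ⟨_, ⟨barycentre, barycentre_mem⟩, rfl⟩) ?_ fun q => ?_
  · rintro q i j ⟨x, hx⟩ ⟨y, hy⟩
    exact isWalk_of_proj_eq (p := (i, x)) (p' := (j, y)) (hx.trans hy.symm)
  · obtain ⟨i, x, rfl⟩ := exists_pt_eq q
    obtain ⟨ε, hε⟩ := exists_small (i, x)
    filter_upwards [(isOpen_nearImage hε).mem_nhds (proj_mem_nearImage_self hε)] with u hu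
    obtain ⟨⟨i, y⟩, ⟨x, hx, -⟩, rfl⟩ := hu
    exact ⟨i, ⟨x, hx.symm⟩, y, rfl⟩

variable (T) in
/-- The dual 1-skeleton, realised in the manifold. -/
noncomputable def realization : Realization T.dual T.Space where
  pos := T.centre
  mid d := T.pt d.1 ⟨faceCentre d.2, faceCentre_mem d.2⟩
  half d := T.halfEdge d.1 d.2
  mid_rev d := T.glue_faceCentre d.1 d.2

variable {x₀ : T.Space}
  (K : ∀ i, FundamentalGroupoid.mk x₀ ⟶ FundamentalGroupoid.mk (T.realization.pos i))

/-- From the basepoint to the barycentre of a tetrahedron, and straight on. -/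
noncomputable def ray (i : Fin T.n) (x : idealTet) :
    FundamentalGroupoid.mk x₀ ⟶ FundamentalGroupoid.mk (T.pt i x) :=
  rayCls convex_idealTet (T.continuous_pt i) (K i) (z := ⟨barycentre, barycentre_mem⟩) rfl x

theorem ray_glue {i : Fin T.n} {f : Fin 4} {j : Fin T.n} (hj : j = T.nbr i f) {x y : idealTet}
    (hx : x.1 f = 0) (hy : y.1 = relabel (T.perm i f) x.1) (h : T.pt i x = T.pt j y) :
    (ray K i x ≫ eqToHom (congrArg _ h) ≫ inv (ray K j y) :
      FundamentalGroup T.Space x₀) = T.realization.gen K (i, f) := by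
  subst hj
  rw [Realization.gen_eq]
  refine rayCls_comp_inv_rayCls (x := ⟨faceCentre f, faceCentre_mem f⟩)
    (x' := ⟨faceCentre (T.perm i f f), faceCentre_mem _⟩) convex_idealTet convex_idealTet
    (T.continuous_pt i) (T.continuous_pt (T.nbr i f)) (K i) (K (T.nbr i f)) rfl rfl rfl rfl
    (T.glue_faceCentre i f) h _ _ (fun _ => rfl) (fun _ => rfl) (glue_segIn rfl ?_ hx ?_ hy)
  · simp [faceCentre]
  · funext a
    simp only [faceCentre, relabel, Equiv.symm_apply_eq]

variable {K} {N : Subgroup (FundamentalGroup T.Space x₀)}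

theorem ray_mem (hN : ∀ d, T.realization.gen K d ∈ N) {i j : Fin T.n} {x y : idealTet}
    (h : T.pt i x = T.pt j y) :
    (ray K i x ≫ eqToHom (congrArg _ h) ≫ inv (ray K j y) : FundamentalGroup T.Space x₀) ∈ N := by
  have key : ∀ p p' : Fin T.n × idealTet, Relation.ReflTransGen T.Glue p p' →
      ∀ h : T.pt p.1 p.2 = T.pt p'.1 p'.2, (ray K p.1 p.2 ≫ eqToHom (congrArg _ h) ≫
        inv (ray K p'.1 p'.2) : FundamentalGroup T.Space x₀) ∈ N := by
    intro p p' h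
    induction h using Relation.ReflTransGen.head_induction_on with
    | refl =>
      intro h
      convert N.one_mem using 1
      simp
    | @head p r hg _ ih =>
      intro h
      have h1 : T.pt p.1 p.2 = T.pt r.1 r.2 := Quot.sound hg
      obtain ⟨f, hf, hj, hr⟩ := id hg
      have h2 := ray_glue K hj hf hr h1
      convert N.mul_mem (ih (h1.symm.trans h)) (h2 ▸ hN (p.1, f)) using 1
      rw [fundamentalGroup_mul_def]
      simp
  exact key (i, x) (j, y) (reflTransGen_of_proj_eq h) h

/-- The loops of the darts generate the fundamental group. -/
theorem eq_top_of_gen_mem (hN : ∀ d, T.realization.gen K d ∈ N)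
    (h₀ : ∃ i x, ∃ h : T.pt i x = x₀, ray K i x ≫ eqToHom (congrArg _ h) = 𝟙 _) : N = ⊤ := by
  refine eq_top_of_locally_mem N
    (fun q => {a | ∃ i x, ∃ h : T.pt i x = q, ray K i x ≫ eqToHom (congrArg _ h) = a})
    (fun q => ?_) ?_ (fun q => ?_) h₀
  · obtain ⟨i, x, rfl⟩ := exists_pt_eq q
    exact ⟨_, i, x, rfl, rfl⟩
  · rintro q _ ⟨i, x, rfl, rfl⟩ _ ⟨j, y, h, rfl⟩
    convert ray_mem hN h.symm using 1
    simp
  · obtain ⟨i, x, rfl⟩ := exists_pt_eq q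
    obtain ⟨ε, hε⟩ := exists_small (i, x)
    obtain ⟨H, hH, h0, h1, hq, hy⟩ := exists_contraction hε
    refine ⟨_, (isOpen_nearImage hε).mem_nhds (proj_mem_nearImage_self hε), fun u γ hγ => ?_⟩
    obtain ⟨j, y, rfl⟩ := exists_pt_eq u
    have hu := hγ 1
    rw [γ.target] at hu
    obtain ⟨x', hx, -, hxy⟩ := hy j y hu
    have hx' : T.pt j x' = T.pt i x := hx.symm
    refine ⟨_, ⟨j, x', hx', rfl⟩, _, ⟨j, y, rfl, rfl⟩, ?_⟩
    convert N.one_mem using 1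
    exact rayCls_comp_cls_of_contraction convex_idealTet (T.continuous_pt j) hH h0 h1 hq (K j)
      rfl hx' (fun _ => hxy) γ hγ

variable (T) in
/-- From a point of a tetrahedron straight to its barycentre. -/
noncomputable def toCentre (i : Fin T.n) (x : idealTet) :
    FundamentalGroupoid.mk (T.pt i x) ⟶ FundamentalGroupoid.mk (T.realization.pos i) :=
  seg convex_idealTet (T.continuous_pt i) x ⟨barycentre, barycentre_mem⟩

variable {S : List (Fin T.n × Fin 4)} (hS : T.dual.IsSpanningTree S) (i : Fin T.n) (x : idealTet)

theorem generator_eq (d : Fin T.n × Fin 4) : T.generator hS i x d =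
    T.realization.gen (T.realization.treeCls hS i (T.toCentre i x)) d := by
  rw [← Realization.cls_treeLoop]
  have h : inv (T.toCentre i x) =
      cls ((segIn convex_idealTet x.2 barycentre_mem).map (T.continuous_pt i)).symm :=
    (cls_symm _).symm
  rw [h]
  rfl

theorem closure_generator :
    Subgroup.closure {g | ∃ d, T.dual.IsGenerator S d ∧ T.generator hS i x d = g} = ⊤ := by
  simp only [generator_eq]
  refine eq_top_of_gen_mem (T.realization.gen_mem_closure hS i (T.toCentre i x)) ⟨i, x, rfl, ?_⟩
  rw [ray, Realization.treeCls_root]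
  exact (Category.comp_id _).trans (rayCls_seg_self convex_idealTet (T.continuous_pt i) x _)

end Generation

end IdealTriangulation

/-! ### The surface -/

/-- A point of a convex hull where a nonnegative coordinate vanishes is in the hull of the points
where it vanishes. -/
theorem mem_convexHull_of_apply_eq_zero {S : Set (Fin 4 → ℝ)} {c : Fin 4}
    (hS : ∀ y ∈ S, 0 ≤ y c) {x : Fin 4 → ℝ} (hx : x ∈ convexHull ℝ S) (h0 : x c = 0) :
    x ∈ convexHull ℝ {y ∈ S | y c = 0} := by
  have : convexHull ℝ S ⊆ {y | 0 ≤ y c ∧ (y c = 0 → y ∈ convexHull ℝ {y ∈ S | y c = 0})} := by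
    refine convexHull_min (fun y hy => ⟨hS y hy, fun h => subset_convexHull ℝ _ ⟨hy, h⟩⟩) ?_
    rintro y ⟨hy, hy'⟩ z ⟨hz, hz'⟩ a b ha hb hab
    refine ⟨?_, fun h => ?_⟩
    · simp only [Pi.add_apply, Pi.smul_apply, smul_eq_mul]
      positivity
    · simp only [Pi.add_apply, Pi.smul_apply, smul_eq_mul] at h
      have h1 : a * y c = 0 := by nlinarith [mul_nonneg ha hy, mul_nonneg hb hz]
      have h2 : b * z c = 0 := by nlinarith [mul_nonneg ha hy, mul_nonneg hb hz]
      rcases mul_eq_zero.1 h1 with rfl | h1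
      · obtain rfl : b = 1 := by linarith
        simpa using hz' (by simpa using h2)
      · rcases mul_eq_zero.1 h2 with rfl | h2
        · obtain rfl : a = 1 := by linarith
          simpa using hy' (by simpa using h1)
        · exact convex_convexHull ℝ _ (hy' h1) (hz' h2) ha hb hab
  exact (this hx).2 h0

namespace DiskType

variable {t : DiskType} {p : Fin 4 → Fin 4 → ℝ}

theorem corner_nonneg (hp : ∀ a b, t.side a ≠ t.side b → 0 < p a b) {e : Fin 4 × Fin 4}
    (he : e ∈ t.edges) (c : Fin 4) : 0 ≤ corner p e c := by
  have hs : t.side e.1 ≠ t.side e.2 := by simpa [edges] using he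
  have h1 := hp _ _ hs
  have h2 := hp _ _ hs.symm
  simp only [corner, Pi.add_apply, Pi.smul_apply, Pi.single_apply, smul_eq_mul]
  split_ifs <;> simp <;> linarith

theorem corner_pos (hp : ∀ a b, t.side a ≠ t.side b → 0 < p a b) {e : Fin 4 × Fin 4}
    (he : e ∈ t.edges) {c : Fin 4} (hc : e.1 = c ∨ e.2 = c) : 0 < corner p e c := by
  have hs : t.side e.1 ≠ t.side e.2 := by simpa [edges] using he
  have h1 := hp _ _ hs
  have h2 := hp _ _ hs.symm
  simp only [corner, Pi.add_apply, Pi.smul_apply, Pi.single_apply, smul_eq_mul]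
  rcases hc with rfl | rfl <;> split_ifs <;> simp_all

theorem exists_edge (t : DiskType) (c : Fin 4) : ∃ e ∈ t.edges, e.1 = c := by
  cases t with
  | tri v => revert v c; decide
  | quad k => revert k c; decide

theorem centroid_pos (hp : ∀ a b, t.side a ≠ t.side b → 0 < p a b) (c : Fin 4) :
    0 < t.centroid p c := by
  simp only [centroid, average, Pi.smul_apply, Finset.sum_apply, smul_eq_mul]
  obtain ⟨e, he, hc⟩ := t.exists_edge c
  refine mul_pos (inv_pos.2 (by exact_mod_cast t.edges_nonempty.card_pos)) ?_
  exact Finset.sum_pos' (fun e he => corner_nonneg hp he c) ⟨e, he, corner_pos hp he (.inl hc)⟩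

/-- A disk meets a face in the convex hull of the corners in the face. -/
theorem mem_arc (hp : ∀ a b, t.side a ≠ t.side b → 0 < p a b) {f g : Fin 4} {x : Fin 4 → ℝ}
    (hx : x ∈ t.sector p g) (h0 : x f = 0) :
    x ∈ convexHull ℝ (corner p '' (t.faceEdges f : Set (Fin 4 × Fin 4))) := by
  refine convexHull_mono ?_ (mem_convexHull_of_apply_eq_zero (c := f) ?_ hx h0)
  · rintro _ ⟨rfl | ⟨e, he, rfl⟩, h⟩
    · exact absurd h (centroid_pos hp f).ne'
    · refine ⟨e, ?_, rfl⟩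
      have he := (Finset.mem_filter.1 (Finset.mem_coe.1 he)).1
      refine Finset.mem_coe.2 (Finset.mem_filter.2 ⟨he, fun h' => ?_, fun h' => ?_⟩)
      · exact (corner_pos hp he (.inl h')).ne' h
      · exact (corner_pos hp he (.inr h')).ne' h
  · rintro _ (rfl | ⟨e, he, rfl⟩)
    · exact (centroid_pos hp f).le
    · exact corner_nonneg hp (Finset.mem_filter.1 (Finset.mem_coe.1 he)).1 f

theorem meets_of_mem_arc {f : Fin 4} {x : Fin 4 → ℝ}
    (hx : x ∈ convexHull ℝ (corner p '' (t.faceEdges f : Set (Fin 4 × Fin 4)))) : t.Meets f := by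
  have := convexHull_nonempty_iff.1 ⟨x, hx⟩
  exact Finset.coe_nonempty.1 this.of_image

theorem arc_subset_sector (f : Fin 4) :
    convexHull ℝ (corner p '' (t.faceEdges f : Set (Fin 4 × Fin 4))) ⊆ t.sector p f :=
  convexHull_mono (Set.subset_insert _ _)

theorem isClosed_sector (f : Fin 4) : IsClosed (t.sector p f) :=
  (((Finset.finite_toSet _).image _).insert _).isClosed_convexHull ℝ

end DiskType

theorem eventually_not_near {A : Set (Fin 4 → ℝ)} (hA : IsClosed A) {x : Fin 4 → ℝ} (hx : x ∉ A) :
    ∀ᶠ ε in 𝓝[>] (0 : ℝ), ∀ y ∈ A, ¬ Near ε x y := by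
  obtain ⟨δ, hδ, h⟩ := Metric.isOpen_iff.1 hA.isOpen_compl x hx
  filter_upwards [eventually_nhdsWithin_of_eventually_nhds (eventually_lt_nhds hδ)] with ε hε y hy hn
  refine h (Metric.mem_ball.2 ((dist_pi_lt_iff hδ).2 fun a => ?_)) hy
  rw [Real.dist_eq]
  exact (hn a).trans hε

namespace NormalSurface

section Generation

variable {T : IdealTriangulation} {F : NormalSurface T}

theorem relabel_mem_sector {D : Fin F.m} {f : Fin 4} (h : (F.type D).Meets f) {x : Fin 4 → ℝ}
    (hx : x ∈ convexHull ℝ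
      (DiskType.corner (F.pos D) '' ((F.type D).faceEdges f : Set (Fin 4 × Fin 4)))) :
    relabel (T.perm (F.tet D) f) x ∈
      (F.type (F.nbr D f)).sector (F.pos (F.nbr D f)) (T.perm (F.tet D) f f) := by
  refine convexHull_min ?_ ((DiskType.convex_sector _).linear_preimage
    (LinearMap.funLeft ℝ ℝ (T.perm (F.tet D) f).symm)) hx
  rintro _ ⟨e, he, rfl⟩
  refine subset_convexHull ℝ _ (Set.mem_insert_of_mem _ ⟨_, (F.faceEdges_nbr h e).2 he, ?_⟩)
  simp only [DiskType.faceEdges, DiskType.edges, Finset.coe_filter, Finset.mem_filter,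
    Finset.mem_univ, true_and, Set.mem_ofPred_eq] at he
  have h1 := F.pos_nbr D f h e.1 e.2 he.2.1 he.2.2 he.1
  have h2 := F.pos_nbr D f h e.2 e.1 he.2.2 he.2.1 he.1.symm
  funext c
  simp [DiskType.corner, h1, h2, Pi.single_apply, Equiv.symm_apply_eq]

/-- The disk `D` contains the point `x` of its tetrahedron. -/
def Holds (F : NormalSurface T) (D : Fin F.m) (p : Fin T.n × idealTet) : Prop :=
  F.tet D = p.1 ∧ p.2.1 ∈ (F.type D).carrier (F.pos D)

theorem Holds.eq {D D' : Fin F.m} {p : Fin T.n × idealTet} (h : F.Holds D p)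
    (h' : F.Holds D' p) : D = D' := by
  by_contra hne
  exact Set.disjoint_left.1 (F.disjoint D D' hne (h.1.trans h'.1.symm)) h.2 h'.2

theorem mem_carrier_iff {D : Fin F.m} {x : Fin 4 → ℝ} : x ∈ (F.type D).carrier (F.pos D) ↔
    ∃ f, (F.type D).Meets f ∧ x ∈ (F.type D).sector (F.pos D) f := by
  simp [DiskType.carrier]

theorem holds_sector {D : Fin F.m} {f : Fin 4} (h : (F.type D).Meets f)
    (x : (F.type D).sector (F.pos D) f) :
    F.Holds D (F.tet D, ⟨x.1, F.sector_subset D f x.2⟩) :=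
  ⟨rfl, mem_carrier_iff.2 ⟨_, h, x.2⟩⟩

theorem Holds.mem_arc {D : Fin F.m} {p : Fin T.n × idealTet} (h : F.Holds D p) {f : Fin 4}
    (hf : p.2.1 f = 0) : p.2.1 ∈ convexHull ℝ
      (DiskType.corner (F.pos D) '' ((F.type D).faceEdges f : Set (Fin 4 × Fin 4))) := by
  obtain ⟨g, -, hg⟩ := mem_carrier_iff.1 h.2
  exact DiskType.mem_arc (F.pos_pos D) hg hf

theorem Holds.nbr {D : Fin F.m} {p p' : Fin T.n × idealTet} (h : F.Holds D p) {f : Fin 4}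
    (hf : p.2.1 f = 0) (h1 : p'.1 = T.nbr p.1 f) (h2 : p'.2.1 = relabel (T.perm p.1 f) p.2.1) :
    F.Holds (F.nbr D f) p' := by
  have ha := h.mem_arc hf
  have hm := DiskType.meets_of_mem_arc ha
  refine ⟨?_, mem_carrier_iff.2 ⟨_, F.meets_nbr hm, ?_⟩⟩
  · rw [F.tet_nbr D f hm, h1, h.1]
  · rw [h2, ← h.1]
    exact relabel_mem_sector hm ha

theorem isWalk_of_holds {D D' : Fin F.m} {p p' : Fin T.n × idealTet} (h : F.Holds D p)
    (h' : F.Holds D' p') (hp : T.proj p = T.proj p') : ∃ l, F.dual.IsWalk D l D' := by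
  have hp' := IdealTriangulation.reflTransGen_of_proj_eq hp
  clear hp
  induction hp' using Relation.ReflTransGen.head_induction_on generalizing D with
  | refl => exact ⟨[], h.eq h'⟩
  | head hg _ ih =>
    obtain ⟨f, hf, h1, h2⟩ := hg
    obtain ⟨l, hl⟩ := ih (h.nbr hf h1 h2)
    exact ⟨⟨(D, f), DiskType.meets_of_mem_arc (h.mem_arc hf)⟩ :: l, rfl, hl⟩

theorem exists_sectorPt_eq (q : F.carrier) : ∃ D f, ∃ h : (F.type D).Meets f, ∃ x,
    F.sectorPt D h x = q := by
  obtain ⟨_, D, x, hx, rfl⟩ := q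
  obtain ⟨f, hf, hx⟩ := mem_carrier_iff.1 hx
  exact ⟨D, f, hf, ⟨x, hx⟩, rfl⟩

/-- A number so small that only sectors through a given point come close to it. -/
theorem exists_small (F : NormalSurface T) (p : Fin T.n × idealTet) : ∃ ε, Small p.2.1 ε ∧
    ∀ π D f, ∀ y ∈ (F.type D).sector (F.pos D) f, Near ε (relabel π p.2.1) y →
      relabel π p.2.1 ∈ (F.type D).sector (F.pos D) f := by
  refine ((eventually_small p.2).and (Filter.eventually_all.2 fun π => Filter.eventually_all.2
    fun D => Filter.eventually_all.2 fun f => ?_)).exists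
  by_cases h : relabel π p.2.1 ∈ (F.type D).sector (F.pos D) f
  · exact .of_forall fun _ _ _ _ => h
  · filter_upwards [eventually_not_near (DiskType.isClosed_sector f) h] with ε hε y hy hn
    exact absurd hn (hε y hy)

/-- Every point of the surface has a neighbourhood that contracts to it along straight lines in
sectors of disks. -/
theorem exists_contraction (q : F.carrier) : ∃ U ∈ 𝓝 q, ∃ H : U × I → F.carrier,
    Continuous H ∧ (∀ u, H (u, 0) = q) ∧ (∀ u, H (u, 1) = u) ∧ (∀ h t, H (⟨q, h⟩, t) = q) ∧
      ∀ D f (h : (F.type D).Meets f) y (_ : F.sectorPt D h y ∈ U), ∃ x, F.sectorPt D h x = q ∧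
        ∀ hy t, H (⟨F.sectorPt D h y, hy⟩, t) =
          F.sectorPt D h (segIn (DiskType.convex_sector f) x.2 y.2 t) := by
  obtain ⟨i, x₀, hq⟩ := IdealTriangulation.exists_pt_eq q.1
  obtain ⟨ε, hε, hsec⟩ := exists_small F (i, x₀)
  obtain ⟨H, hH, h0, h1, hq', hy⟩ := IdealTriangulation.exists_contraction hε
  have hq : T.proj (i, x₀) = q := hq
  let U : Set F.carrier := Subtype.val ⁻¹' IdealTriangulation.nearImage (i, x₀) ε
  have key : ∀ D f (h : (F.type D).Meets f) y (hu : F.sectorPt D h y ∈ U), ∃ x,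
      F.sectorPt D h x = q ∧ ∀ t, H (⟨(F.sectorPt D h y).1, hu⟩, t) =
        (F.sectorPt D h (segIn (DiskType.convex_sector f) x.2 y.2 t)).1 := by
    intro D f h y hu
    obtain ⟨x, hx, hn, hxy⟩ := hy (F.tet D) ⟨y.1, F.sector_subset D f y.2⟩ hu
    have hxs : x.1 ∈ (F.type D).sector (F.pos D) f := by
      obtain ⟨π, hπ⟩ := hx.exists_relabel
      rw [hπ] at hn ⊢
      exact hsec π D f _ y.2 hn
    exact ⟨⟨x.1, hxs⟩, Subtype.ext (hx.symm.trans hq), hxy⟩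
  have hmem : ∀ z : U × I, H (⟨z.1.1.1, z.1.2⟩, z.2) ∈ F.carrier := by
    rintro ⟨⟨u, hu⟩, t⟩
    obtain ⟨D, f, h, y, rfl⟩ := exists_sectorPt_eq u
    obtain ⟨x, -, hx⟩ := key D f h y hu
    rw [hx t]
    exact Subtype.property _
  refine ⟨U, (((IdealTriangulation.isOpen_nearImage hε).preimage
    continuous_subtype_val).mem_nhds ?_), fun z => ⟨H (⟨z.1.1.1, z.1.2⟩, z.2), hmem z⟩, ?_,
    fun u => Subtype.ext ((h0 _).trans hq), fun u => Subtype.ext (h1 _),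
    fun h t => Subtype.ext ?_, fun D f h y hu => ?_⟩
  · rw [Set.mem_preimage, ← hq]
    exact IdealTriangulation.proj_mem_nearImage_self hε
  · exact Continuous.subtype_mk (hH.comp (by fun_prop)) _
  · have : ∀ (u : T.Space) (hu : T.proj (i, x₀) = u) (h : u ∈ _), H (⟨u, h⟩, t) = u := by
      rintro u rfl h
      exact hq' h t
    exact this _ hq _
  · obtain ⟨x, hx, hx'⟩ := key D f h y hu
    exact ⟨x, hx, fun _ t => Subtype.ext (hx' t)⟩

theorem dual_connected (hF : IsConnected F.carrier) : F.dual.Connected := by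
  have := isConnected_iff_connectedSpace.1 hF
  refine connected_of_labels (X := F.carrier)
    (fun q D => ∃ f, ∃ h : (F.type D).Meets f, ∃ x, F.sectorPt D h x = q) (fun D => ?_) ?_
    fun q => ?_
  · obtain ⟨f, h, -⟩ := mem_carrier_iff.1 (F.centroid_mem_carrier D)
    exact ⟨_, f, h, ⟨_, DiskType.centroid_mem_sector f⟩, rfl⟩
  · rintro q D D' ⟨f, h, x, hx⟩ ⟨f', h', x', hx'⟩
    exact isWalk_of_holds (holds_sector h x) (holds_sector h' x') (congrArg Subtype.val (hx.trans hx'.symm))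
  · obtain ⟨U, hU, H, -, -, -, -, hy⟩ := exists_contraction q
    filter_upwards [hU] with u hu
    obtain ⟨D, f, h, y, rfl⟩ := exists_sectorPt_eq u
    obtain ⟨x, hx, -⟩ := hy D f h y hu
    exact ⟨D, ⟨f, h, x, hx⟩, f, h, y, rfl⟩

variable (F) in
/-- The dual 1-skeleton, realised in the surface. -/
noncomputable def realization : Realization F.dual F.carrier where
  pos := F.centre
  mid := F.mid
  half := F.halfEdge
  mid_rev := F.mid_rev

variable {x₀ : F.carrier}
  (K : ∀ D, FundamentalGroupoid.mk x₀ ⟶ FundamentalGroupoid.mk (F.realization.pos D))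

/-- From the basepoint to the centroid of a disk, and straight on in a sector. -/
noncomputable def ray (D : Fin F.m) {f : Fin 4} (h : (F.type D).Meets f)
    (x : (F.type D).sector (F.pos D) f) :
    FundamentalGroupoid.mk x₀ ⟶ FundamentalGroupoid.mk (F.sectorPt D h x) :=
  rayCls (DiskType.convex_sector f) (F.continuous_sectorPt D h) (K D)
    (z := ⟨_, DiskType.centroid_mem_sector f⟩) rfl x

theorem ray_comp_eqToHom {D : Fin F.m} {f f' : Fin 4} (h : (F.type D).Meets f)
    (h' : (F.type D).Meets f') {x : (F.type D).sector (F.pos D) f}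
    {x' : (F.type D).sector (F.pos D) f'} (hx : x.1 = x'.1)
    (hq : F.sectorPt D h x = F.sectorPt D h' x') :
    ray K D h x ≫ eqToHom (congrArg _ hq) = ray K D h' x' := by
  obtain ⟨x, hx1⟩ := x
  obtain ⟨x', hx2⟩ := x'
  obtain rfl : x = x' := hx
  exact rayCls_comp_eqToHom _ _ _ _ _ _ _ hq fun t => rfl

theorem arcMid_apply_self (D : Fin F.m) (f : Fin 4) :
    (F.type D).arcMid (F.pos D) f f = 0 := by
  simp only [DiskType.arcMid, average, Pi.smul_apply, Finset.sum_apply, smul_eq_mul]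
  refine mul_eq_zero_of_right _ (Finset.sum_eq_zero fun e he => ?_)
  have he := (Finset.mem_filter.1 he).2
  simp [DiskType.corner, he.1.symm, he.2.symm]

theorem ray_glue {D : Fin F.m} {f : Fin 4} (h : (F.type D).Meets f)
    {x : (F.type D).sector (F.pos D) f}
    {y : (F.type (F.nbr D f)).sector (F.pos (F.nbr D f)) (T.perm (F.tet D) f f)}
    (hx : x.1 f = 0) (hy : y.1 = relabel (T.perm (F.tet D) f) x.1)
    (hq : F.sectorPt D h x = F.sectorPt (F.nbr D f) (F.meets_nbr h) y) :
    (ray K D h x ≫ eqToHom (congrArg _ hq) ≫ inv (ray K (F.nbr D f) (F.meets_nbr h) y) :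
      FundamentalGroup F.carrier x₀) = F.realization.gen K ⟨(D, f), h⟩ := by
  refine Eq.trans ?_ (Realization.gen_eq _ _ _).symm
  refine rayCls_comp_inv_rayCls (x := ⟨_, DiskType.arcMid_mem_sector h⟩)
    (x' := ⟨_, DiskType.arcMid_mem_sector (F.meets_nbr h)⟩) (DiskType.convex_sector _)
    (DiskType.convex_sector _) (F.continuous_sectorPt _ _) (F.continuous_sectorPt _ _) (K D)
    (K (F.nbr D f)) rfl rfl rfl rfl (F.mid_rev ⟨(D, f), h⟩) hq _ _ (fun _ => rfl)
    (fun _ => rfl) fun t => Subtype.ext (IdealTriangulation.glue_segIn (F.tet_nbr D f h)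
      (x := ⟨_, F.sector_subset D f (DiskType.arcMid_mem_sector h)⟩)
      (y := ⟨_, F.sector_subset D f x.2⟩)
      (x' := ⟨_, F.sector_subset _ _ (DiskType.arcMid_mem_sector (F.meets_nbr h))⟩)
      (y' := ⟨_, F.sector_subset _ _ y.2⟩) (arcMid_apply_self D f) hx (F.arcMid_nbr h) hy t)

variable {K} {N : Subgroup (FundamentalGroup F.carrier x₀)}

theorem ray_mem (hN : ∀ d, F.realization.gen K d ∈ N) {D D' : Fin F.m} {f f' : Fin 4}
    (h : (F.type D).Meets f) (h' : (F.type D').Meets f') {x : (F.type D).sector (F.pos D) f}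
    {x' : (F.type D').sector (F.pos D') f'} (hq : F.sectorPt D h x = F.sectorPt D' h' x') :
    (ray K D h x ≫ eqToHom (congrArg _ hq) ≫ inv (ray K D' h' x') :
      FundamentalGroup F.carrier x₀) ∈ N := by
  have key : ∀ p, Relation.ReflTransGen T.Glue p
      (F.tet D', ⟨x'.1, F.sector_subset D' f' x'.2⟩) → ∀ (D : Fin F.m) (f : Fin 4)
      (h : (F.type D).Meets f) (x : (F.type D).sector (F.pos D) f), F.tet D = p.1 →
      x.1 = p.2.1 → ∀ hq : F.sectorPt D h x = F.sectorPt D' h' x',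
      (ray K D h x ≫ eqToHom (congrArg _ hq) ≫ inv (ray K D' h' x') :
        FundamentalGroup F.carrier x₀) ∈ N := by
    intro p hp
    induction hp using Relation.ReflTransGen.head_induction_on with
    | refl =>
      intro D f h x hD hx hq
      obtain rfl : D = D' := Holds.eq ⟨hD, hx ▸ (holds_sector h x).2⟩ (holds_sector h' x')
      convert N.one_mem using 1
      rw [← Category.assoc, ray_comp_eqToHom K h h' hx hq, IsIso.hom_inv_id]
      rfl
    | @head p r hg _ ih =>
      intro D f h x hD hx hq
      obtain ⟨g, hg, h1, h2⟩ := hg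
      have hp : F.Holds D p := ⟨hD, hx ▸ (holds_sector h x).2⟩
      have ha := hp.mem_arc hg
      have hm := DiskType.meets_of_mem_arc ha
      have hxg : x.1 g = 0 := by rw [hx, hg]
      rw [← hx] at ha
      let y : (F.type D).sector (F.pos D) g := ⟨x.1, DiskType.arc_subset_sector g ha⟩
      let z : (F.type (F.nbr D g)).sector (F.pos (F.nbr D g)) (T.perm (F.tet D) g g) :=
        ⟨_, relabel_mem_sector hm ha⟩
      have hxy : F.sectorPt D h x = F.sectorPt D hm y := rfl
      have hyz : F.sectorPt D hm y = F.sectorPt (F.nbr D g) (F.meets_nbr hm) z :=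
        Subtype.ext (Quot.sound ⟨g, hxg, F.tet_nbr D g hm, rfl⟩)
      have e1 := ray_comp_eqToHom K h hm (x' := y) rfl hxy
      have e2 := ray_glue K hm (x := y) (y := z) hxg rfl hyz
      have hz := ih (F.nbr D g) _ (F.meets_nbr hm) z ((F.tet_nbr D g hm).trans (by rw [h1, hD]))
        (by rw [h2, ← hx, ← hD]) (hyz.symm.trans (hxy.symm.trans hq))
      convert N.mul_mem hz (e2 ▸ hN ⟨(D, g), hm⟩) using 1
      rw [fundamentalGroup_mul_def, ← e1]
      simp
  exact key _ (IdealTriangulation.reflTransGen_of_proj_eq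
    (p := (F.tet D, ⟨x.1, F.sector_subset D f x.2⟩)) (congrArg Subtype.val hq)) D f h x rfl rfl hq

/-- The loops of the darts generate the fundamental group. -/
theorem eq_top_of_gen_mem (hN : ∀ d, F.realization.gen K d ∈ N)
    (h₀ : ∃ D f, ∃ h : (F.type D).Meets f, ∃ x, ∃ hq : F.sectorPt D h x = x₀,
      ray K D h x ≫ eqToHom (congrArg _ hq) = 𝟙 _) : N = ⊤ := by
  refine eq_top_of_locally_mem N
    (fun q => {a | ∃ D f, ∃ h : (F.type D).Meets f, ∃ x, ∃ hq : F.sectorPt D h x = q,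
      ray K D h x ≫ eqToHom (congrArg _ hq) = a}) (fun q => ?_) ?_ (fun q => ?_) h₀
  · obtain ⟨D, f, h, x, rfl⟩ := exists_sectorPt_eq q
    exact ⟨_, D, f, h, x, rfl, rfl⟩
  · rintro q _ ⟨D, f, h, x, rfl, rfl⟩ _ ⟨D', f', h', x', hq, rfl⟩
    convert ray_mem hN h h' hq.symm using 1
    simp
  · obtain ⟨U, hU, H, hH, h0, h1, hq, hy⟩ := exists_contraction q
    refine ⟨U, hU, fun u γ hγ => ?_⟩
    obtain ⟨D, f, h, y, rfl⟩ := exists_sectorPt_eq u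
    have hu := hγ 1
    rw [γ.target] at hu
    obtain ⟨x, hx, hxy⟩ := hy D f h y hu
    refine ⟨_, ⟨D, f, h, x, hx, rfl⟩, _, ⟨D, f, h, y, rfl, rfl⟩, ?_⟩
    convert N.one_mem using 1
    exact rayCls_comp_cls_of_contraction (DiskType.convex_sector f) (F.continuous_sectorPt D h)
      hH h0 h1 hq (K D) rfl hx hxy γ hγ

variable {S : List F.Dart} (hS : F.dual.IsSpanningTree S) (b : Fin F.m)

theorem generator_eq (e : F.Dart) :
    F.generator hS b e = F.realization.gen (F.realization.treeCls hS b (𝟙 _)) e := by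
  rw [← Realization.cls_treeLoop, IsIso.inv_id, Category.comp_id, Category.id_comp]
  rfl

theorem closure_generator :
    Subgroup.closure {g | ∃ e, F.dual.IsGenerator S e ∧ F.generator hS b e = g} = ⊤ := by
  simp only [generator_eq]
  obtain ⟨f, h, -⟩ := mem_carrier_iff.1 (F.centroid_mem_carrier b)
  refine eq_top_of_gen_mem (F.realization.gen_mem_closure hS b (𝟙 _))
    ⟨b, f, h, ⟨_, DiskType.centroid_mem_sector f⟩, rfl, ?_⟩
  have e := rayCls_seg_self (DiskType.convex_sector f) (F.continuous_sectorPt b h)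
    ⟨_, DiskType.centroid_mem_sector f⟩ ⟨_, DiskType.centroid_mem_sector f⟩
  rw [seg_self] at e
  have hK := F.realization.treeCls_root hS b (𝟙 _)
  exact (Category.comp_id _).trans ((congrArg (fun k => rayCls (DiskType.convex_sector f)
    (F.continuous_sectorPt b h) (z := ⟨_, DiskType.centroid_mem_sector f⟩) k rfl
    ⟨_, DiskType.centroid_mem_sector f⟩) hK).trans e)

/-! The homomorphism induced by the inclusion. -/

section Inclusion

variable {y₀ : T.Space}
  (L : ∀ i, FundamentalGroupoid.mk y₀ ⟶ FundamentalGroupoid.mk (T.realization.pos i))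

/-- From the basepoint to the barycentre of the tetrahedron of a disk, and straight on to the
centroid of the disk. -/
noncomputable def rayCentre (D : Fin F.m) :
    FundamentalGroupoid.mk y₀ ⟶ FundamentalGroupoid.mk ((F.realization.map F.incl).pos D) :=
  IdealTriangulation.ray L (F.tet D) ⟨_, F.centroid_mem D⟩

theorem comp_inv_comp {X : Type} [TopologicalSpace X] {x u v m m' : X}
    {a : FundamentalGroupoid.mk x ⟶ FundamentalGroupoid.mk u}
    {b : FundamentalGroupoid.mk x ⟶ FundamentalGroupoid.mk v}
    {α : FundamentalGroupoid.mk u ⟶ FundamentalGroupoid.mk m}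
    {β : FundamentalGroupoid.mk v ⟶ FundamentalGroupoid.mk m'}
    {a' : FundamentalGroupoid.mk x ⟶ FundamentalGroupoid.mk m}
    {b' : FundamentalGroupoid.mk x ⟶ FundamentalGroupoid.mk m'}
    (h : a ≫ α = a') (h' : b ≫ β = b')
    (ε : FundamentalGroupoid.mk m ⟶ FundamentalGroupoid.mk m') :
    a ≫ α ≫ ε ≫ inv β ≫ inv b = a' ≫ ε ≫ inv b' := by
  subst h h'
  simp

theorem conj_of_eq_id {X : Type} [TopologicalSpace X] {x : X}
    {a : FundamentalGroupoid.mk x ⟶ FundamentalGroupoid.mk x} (h : a = 𝟙 _)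
    (g : FundamentalGroupoid.mk x ⟶ FundamentalGroupoid.mk x) : a ≫ g ≫ inv a = g := by
  subst h
  simp

/-- The loop in the manifold of a dual edge of the surface is that of the corresponding dual edge of
the manifold. -/
theorem gen_rayCentre (e : F.Dart) : (F.realization.map F.incl).gen (rayCentre L) e =
    T.realization.gen L (F.toDart e) := by
  obtain ⟨⟨D, f⟩, h⟩ := e
  have hD := F.sector_subset D f (DiskType.arcMid_mem_sector h)
  have hD' := F.sector_subset _ _ (DiskType.arcMid_mem_sector (F.meets_nbr h))
  have h1 : T.pt (F.tet D) ⟨_, hD⟩ = T.pt (F.tet (F.nbr D f)) ⟨_, hD'⟩ :=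
    congrArg Subtype.val (F.mid_rev ⟨(D, f), h⟩)
  refine (Realization.gen_eq _ _ _).trans (Eq.trans ?_ (IdealTriangulation.ray_glue L
    (F.tet_nbr D f h) (arcMid_apply_self D f) (F.arcMid_nbr h) h1))
  have key : ∀ (D : Fin F.m) (f : Fin 4) (h : (F.type D).Meets f) hD,
      IdealTriangulation.ray L (F.tet D) ⟨_, F.centroid_mem D⟩ ≫
        cls ((F.realization.map F.incl).half ⟨(D, f), h⟩) =
      IdealTriangulation.ray L (F.tet D) ⟨(F.type D).arcMid (F.pos D) f, hD⟩ :=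
    fun D f h hD => rayCls_comp_cls convex_idealTet (T.continuous_pt (F.tet D)) (L (F.tet D))
      (z := ⟨_, IdealTriangulation.barycentre_mem⟩) (x := ⟨_, F.centroid_mem D⟩) (y := ⟨_, hD⟩) rfl
      ((F.realization.map F.incl).half ⟨(D, f), h⟩) fun _ => rfl
  exact comp_inv_comp (key D f h hD) (key _ _ (F.meets_nbr h) hD') _

end Inclusion

variable {S' : List (Fin T.n × Fin 4)} (hS' : T.dual.IsSpanningTree S')

theorem map_generator {e : F.Dart} {γ : List F.Dart} (hγ : ∃ l l', γ = l ++ e :: l' ∧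
    F.IsTreeWalk S b l (F.dual.src e) ∧ F.IsTreeWalk S (F.dual.tgt e) l' b) :
    FundamentalGroup.map F.incl (F.centre b) (F.generator hS b e) =
      evalWord (T.generator hS' (F.tet b) ⟨_, F.centroid_mem b⟩) (F.readWord S' γ) := by
  classical
  let τ := T.toCentre (F.tet b) ⟨_, F.centroid_mem b⟩
  let L := T.realization.treeCls hS' (F.tet b) τ
  have hgen : T.generator hS' (F.tet b) ⟨_, F.centroid_mem b⟩ = T.realization.gen L :=
    funext fun d => IdealTriangulation.generator_eq hS' _ _ d
  have hb : rayCentre L b = 𝟙 _ := by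
    have := rayCls_seg_self convex_idealTet (T.continuous_pt (F.tet b)) ⟨_, F.centroid_mem b⟩
      ⟨_, IdealTriangulation.barycentre_mem⟩
    refine Eq.trans ?_ this
    have hL : L (F.tet b) = τ := Realization.treeCls_root _ _ _ _
    unfold rayCentre IdealTriangulation.ray
    rw [hL]
    rfl
  have h1 : FundamentalGroup.map F.incl (F.centre b) (F.generator hS b e) =
      cls ((DualGraph.treeLoop hS b e).path (F.realization.map F.incl).edge) := by
    rw [Realization.map_path]
    rfl
  have h2 := (conj_of_eq_id hb _).symm.trans
    ((F.realization.map F.incl).cls_path (rayCentre L) (DualGraph.treeLoop hS b e))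
  have h3 := T.realization.evalWord_flatMap hS' (F.tet b) τ F.toDart γ
  refine h1.trans (h2.trans (Eq.trans ?_ (Eq.trans h3.symm (by rw [hgen]; rfl))))
  obtain ⟨l, l', rfl, hl, hl'⟩ := hγ
  simp only [gen_rayCentre]
  have hrev : ∀ d, op (T.realization.gen L (F.toDart (F.dual.rev d))) =
      (op (T.realization.gen L (F.toDart d)))⁻¹ := fun d => by
    rw [F.toDart_rev, Realization.op_gen_rev]
  have e1 := hS.prod_eq (g := fun d => op (T.realization.gen L (F.toDart d))) hrev
    (DualGraph.treeWalk hS b (F.dual.src e)).isWalk_darts (DualGraph.treeWalk_inTree hS _ _)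
    hl.1 hl.2
  have e2 := hS.prod_eq (g := fun d => op (T.realization.gen L (F.toDart d))) hrev
    (DualGraph.treeWalk hS (F.dual.tgt e) b).isWalk_darts (DualGraph.treeWalk_inTree hS _ _)
    hl'.1 hl'.2
  rw [DualGraph.treeLoop_darts, List.map_append, List.map_append, List.prod_append,
    List.prod_append, List.map_cons, List.map_cons, List.prod_cons, List.prod_cons, e1, e2]

end Generation

end NormalSurface

theorem DualGraph.isGenerator_letter {V D : Type} {G : DualGraph V D} {S : List D} {d : D}
    (h : ¬ G.InTree S d) : G.IsGenerator S (G.letter d).1 := by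
  cases hp : G.positive d with
  | true => simpa [DualGraph.letter, hp] using ⟨hp, h⟩
  | false =>
    have h1 : G.positive (G.rev d) = true := by rw [G.positive_rev, hp]; rfl
    refine ⟨by simpa [DualGraph.letter, hp] using h1, fun h' => h ?_⟩
    rw [← G.rev_rev d]
    exact DualGraph.InTree.rev (by simpa [DualGraph.letter, hp] using h')

theorem NormalCells.isGenerator_of_mem_readWord {T : IdealTriangulation} (F : NormalCells T)
    {S : List (Fin T.n × Fin 4)} {γ : List F.Dart} {l : (Fin T.n × Fin 4) × Bool}
    (hl : l ∈ F.readWord S γ) : T.dual.IsGenerator S l.1 := by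
  obtain ⟨d, -, hd⟩ := List.mem_flatMap.1 hl
  split_ifs at hd with h
  · simp at hd
  · rw [List.mem_singleton.1 hd]
    exact DualGraph.isGenerator_letter h

end SkeletalEmbedding

theorem mainTheorem5 (T : SkeletalEmbedding.IdealTriangulation) (hM : ConnectedSpace T.Space)
    (F : SkeletalEmbedding.NormalSurface T) (hF : IsConnected F.carrier) :
    -- the algorithm has no infinite run
    (¬ ∃ s : ℕ → F.AlgState, s 0 = .start ∧ ∀ k, F.Step (s k) (s (k + 1))) ∧
    -- a run can always be continued until the algorithm halts with an output
    (∀ s : F.AlgState, Relation.ReflTransGen F.Step .start s →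
      (∃ s', F.Step s s') ∨ ∃ R out, s = .done R out) ∧
    -- every output is correct
    (∀ R out, Relation.ReflTransGen F.Step .start (.done R out) →
      ∃ (hS : F.dual.IsSpanningTree R.treeF) (hS' : T.dual.IsSpanningTree R.treeM),
        Subgroup.closure {g | ∃ e, F.dual.IsGenerator R.treeF e ∧ F.generator hS R.base e = g} = ⊤ ∧
        Subgroup.closure {g | ∃ d, T.dual.IsGenerator R.treeM d ∧
          T.generator hS' (F.tet R.base) ⟨_, F.centroid_mem R.base⟩ d = g} = ⊤ ∧
        (out.map Prod.fst).Nodup ∧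
        (∀ e, e ∈ out.map Prod.fst ↔ F.dual.IsGenerator R.treeF e) ∧
        ∀ e w, (e, w) ∈ out →
          (∀ l ∈ w, T.dual.IsGenerator R.treeM l.1) ∧
          FundamentalGroup.map F.incl (F.centre R.base) (F.generator hS R.base e) =
            SkeletalEmbedding.evalWord
              (T.generator hS' (F.tet R.base) ⟨_, F.centroid_mem R.base⟩) w) := by
  have hconn := SkeletalEmbedding.NormalSurface.dual_connected hF
  have hm : Nonempty (Fin F.m) := by
    obtain ⟨_, D, _⟩ := hF.nonempty
    exact ⟨D⟩
  refine ⟨SkeletalEmbedding.NormalCells.no_infinite_run, fun s hs =>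
    SkeletalEmbedding.NormalCells.exists_step hconn
      (SkeletalEmbedding.IdealTriangulation.dual_connected hM) hm s
      (SkeletalEmbedding.NormalCells.inv_of_reachable hs), fun R out hs => ?_⟩
  obtain ⟨hR, hout, hall⟩ := SkeletalEmbedding.NormalCells.inv_of_reachable hs
  have hS := hR.grownF.isSpanningTree hR.reachedF
  have hS' := hR.grownM.isSpanningTree hR.reachedM
  refine ⟨hS, hS', SkeletalEmbedding.NormalSurface.closure_generator hS R.base,
    SkeletalEmbedding.IdealTriangulation.closure_generator hS' _ _, hout.1,
    fun e => ⟨fun he => ?_, hall e⟩, fun e w hew => ?_⟩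
  · obtain ⟨p, hp, rfl⟩ := List.mem_map.1 he
    exact (hout.2 p hp).1
  · obtain ⟨-, γ, hγ, rfl⟩ := hout.2 _ hew
    exact ⟨fun l hl => SkeletalEmbedding.NormalCells.isGenerator_of_mem_readWord _ hl,
      SkeletalEmbedding.NormalSurface.map_generator hS R.base hS' hγ⟩
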